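/- \textbf{Setting.} Let $Z=(X,Y)$ be an observation with values in $\mathcal X\times\mathcal Y$ ($\mathcal X$ a measurable space, $\mathcal Y$ a non-empty standard Borel space), let $(\mathcal H,\|\cdot\|_{\mathbf H})$ be a real Banach space, $\Theta\subset\mathbb R^{d_\theta}$ compact, $\mathcal A=\Theta\times\mathcal H$, and for $v=(v_\theta,v_h)\in\mathbb R^{d_\theta}\times\mathcal H$ put $\|v\|_s=\|v_\theta\|+\|v_h\|_{\mathbf H}$. Let $\rho(z;\alpha)\in\mathbb R^{d_\rho}$ be a residual function, measurable in $z$ for $\alpha\in\mathcal A$, let $\Sigma(x)$ be symmetric, measurable in $x$, with eigenvalues bounded and bounded away from $0$ uniformly in $x$, and for a law $P$ of $Z$ let $m_P(x,\alpha)=E_P[\rho(Z;\alpha)\mid X=x]$ and $Q_P(\alpha)=E_P[m_P(X,\alpha)'\Sigma(X)^{-1}m_P(X,\alpha)]$. We say that $P$ is generated by the model at $a\in\mathcal A$ if these expectations exist for all $\alpha\in\mathcal A$ and, for $\alpha\in\mathcal A$, $m_P(X,\alpha)=0$ a.s. if and only if $\alpha=a$. Let $P_0$ be generated by the model at $\alpha_0=(\theta_0,h_0)$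 with $\theta_0\in\mathrm{int}\,\Theta$, let $\rho(Z;\alpha_0)$ be square integrable and let $\Sigma_0(X)=\mathrm{Var}(\rho(Z;\alpha_0)\mid X)$ have eigenvalues a.s. bounded and bounded away from $0$. Let $dm(x,\alpha_0)[v]$ be the derivative of $\tau\mapsto m_{P_0}(x,\alpha_0+\tau v)$ at $\tau=0$, and, with expectations and variance under $P_0$, $$\langle v,w\rangle=E\big[dm(X,\alpha_0)[v]'\Sigma(X)^{-1}dm(X,\alpha_0)[w]\big],\quad \|v\|=\langle v,v\rangle^{1/2},\quad \|v\|_{sd}^2=\mathrm{Var}\big(dm(X,\alpha_0)[v]'\Sigma(X)^{-1}\rho(Z;\alpha_0)\big).$$ \textbf{Sieves, penalty and rates.} $\mathcal H_1\subset\mathcal H_2\subset\cdots$ are finite dimensional subspaces of $\mathcal H$ with dense union, $k(n)\to\infty$, $\mathcal A_{k(n)}=\Theta\times\mathcal H_{k(n)}$, $\mathbf V_n=\mathbb R^{d_\theta}\times\mathcal H_{k(n)}$; $\Pi_nh\in\mathcal H_{k(n)}$ for $h\in\mathcal H$, $\Pi_n(\theta,h)=(\theta,\Pi_nh)$, $\|\Pi_nh_0-h_0\|_{\mathbf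 H}\to0$. $Pen:\mathcal H\to[0,\infty]$ has compact sublevel sets $\{Pen\le K\}$, $K<\infty$; $\lambda_n>0$; $0<\delta_n\le\bar\delta_n$, $\delta_n\to 0$, $\bar\delta_n\to0$; $n^{-1}=O(\delta_n^2)$; and for all large $n$, $\lambda_n\le\delta_n^2$, $Q_{P_0}(\Pi_n\alpha_0)\le\delta_n^2$ and $Pen(\Pi_nh_0)\le M_0$, where $M_0<\infty$. $\mathcal A_{os}\ni\alpha_0$ is a convex subset of $\{\alpha\in\mathcal A:\|\alpha-\alpha_0\|_s<M_0,\ Pen(h)\le M_0\}$ which contains all $\alpha\in\mathcal A$ with $\|\alpha-\alpha_0\|_s<r$, $Pen(h)\le M_0$ for some $r>0$; $\mathcal A_{osn}=\mathcal A_{os}\cap\mathcal A_{k(n)}$. Let $\mathbf V=\mathrm{span}(\mathcal A_{os}-\alpha_0)$. For $v\in\mathbf V$ the derivative $dm(X,\alpha_0)[v]$ exists a.s., is linear in $v$ (a.s.) and square integrable; $\|\alpha-\alpha_0\|\le C\|\alpha-\alpha_0\|_s$ and $c\|\alpha-\alpha_0\|^2\le Q_{P_0}(\alpha)\le C\|\alpha-\alpha_0\|^2$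 on $\mathcal A_{os}$ for constants $0<c\le C<\infty$; $\mathbf V_n\subset\mathbf V$, and $\|v\|\ne0$ for $0\neq v\in\mathbf V_n$. Put $$\tau_n=\sup_{\alpha\in\mathcal A_{osn},\,\|\alpha-\Pi_n\alpha_0\|\ne0}\frac{\|\alpha-\Pi_n\alpha_0\|_s}{\|\alpha-\Pi_n\alpha_0\|},\qquad \delta_{s,n}=\|h_0-\Pi_nh_0\|_{\mathbf H}+\tau_n\delta_n,$$ assume $\delta_{s,n}>0$ for large $n$ and $\delta_{s,n}\to0$, and let $M_n=\min\{\log\log(n+1),\log(\delta_{s,n}^{-1}+1)\}$, $\mathcal T_n=\{t\in\mathbb R:|t|\le4M_n^2\delta_n\}$, $$\mathcal N_{os}=\{\alpha\in\mathcal A:\|\alpha-\alpha_0\|\le M_n\delta_n,\ \|\alpha-\alpha_0\|_s\le M_n\delta_{s,n},\ Pen(h)\le M_0\},\qquad\mathcal N_{osn}=\mathcal N_{os}\cap\mathcal A_{k(n)}.$$ \textbf{Functional.} $\phi:\mathbb R^{d_\theta}\times\mathcal H\to\mathbb R$ is continuous for $\|\cdot\|_s$, $\phi(\alpha_0)=\phi_0$,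 and the directional derivative $d\phi(\alpha_0)[v]$ exists for all $v$, is linear, $\|\cdot\|_s$-bounded, and non-zero on $\mathbf V$. Let $v_n^*\in\mathbf V_n$ satisfy $d\phi(\alpha_0)[v]=\langle v_n^*,v\rangle$ for all $v\in\mathbf V_n$, $u_n^*=v_n^*/\|v_n^*\|_{sd}$, and let $\alpha_{0,n}$ minimize $\|\alpha-\alpha_0\|$ over $\alpha\in\mathbf V_n$. Assume $\|v_n^*\|=o(\sqrt n)$, $\sqrt n\,|d\phi(\alpha_0)[\alpha_{0,n}-\alpha_0]|=o(\|v_n^*\|)$, and, uniformly over $(\alpha,t)\in\mathcal N_{osn}\times\mathcal T_n$, $$\sqrt n\,\big|\phi(\alpha+tu_n^*)-\phi(\alpha_0)-d\phi(\alpha_0)[\alpha+tu_n^*-\alpha_0]\big|=o(\|v_n^*\|).$$ The penalty is negligible: $\lambda_n|Pen(h)-Pen(h')|=o(n^{-1})$ uniformly over $\alpha,\alpha'\in\mathcal A_{os}\cup\{\alpha+tu_n^*:\alpha\in\mathcal N_{osn},t\in\mathcal T_n\}$ (with $Pen$ finite on this set for large $n$). \textbf{Local alternatives.} Let $\boldsymbol\alpha_n=\alpha_0+d_n\Delta_n$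 with $d_n\ge0$, $\Delta_n\in\mathbf V_n$, $d\phi(\alpha_0)[\Delta_n]\to\kappa\ne0$, and, for all large $n$, $\boldsymbol\alpha_n\in\mathcal N_{os}$, $d_n\|\Delta_n\|\le cM_n\delta_n$ for some $c<1$, $d_n\|\Delta_n\|_s\le M_n\delta_{s,n}$. Let $P_n$ be generated by the model at $\boldsymbol\alpha_n$ and write $Q_n=Q_{P_n}$. Assume: for $\alpha\in\mathcal A$ and $b<Q_{P_0}(\alpha)$ there is $r>0$ such that for all large $n$, $Q_n(\alpha')>b$ for every $\alpha'\in\mathcal A$ with $\|\alpha'-\alpha\|_s<r$; there are constants $0<c\le C$ with $c\|\alpha-\boldsymbol\alpha_n\|^2\le Q_n(\alpha)\le C\|\alpha-\boldsymbol\alpha_n\|^2$ on $\mathcal A_{os}$ for all large $n$; with $\boldsymbol\alpha_n=(\boldsymbol\theta_n,\boldsymbol h_n)$, $\|\Pi_n\boldsymbol h_n-\boldsymbol h_n\|_{\mathbf H}\to0$ and, for all large $n$, $Pen(\Pi_n\boldsymbol h_n)\le M_0$ and $Q_n(\Pi_n\boldsymbol\alpha_n)\le\delta_n^2$. \textbf{Sample.}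 For each $n$ let $Z_1,\dots,Z_n$ be i.i.d. with law $P_n$; all stochastic orders below refer to these laws (outer probabilities where needed). Let $\widehat m_n(x,\alpha)$, $\widehat\Sigma_n(x)$ be functions of the sample, $\widehat Q_n(\alpha)=n^{-1}\sum_{i=1}^n\widehat m_n(X_i,\alpha)'\widehat\Sigma_n(X_i)^{-1}\widehat m_n(X_i,\alpha)$. Let $\widehat\alpha_n\in\mathcal A_{k(n)}$, $\widehat\alpha_n^R\in\mathcal A^R_{k(n)}=\{\alpha\in\mathcal A_{k(n)}:\phi(\alpha)=\phi_0\}$ minimize $\widehat Q_n(\alpha)+\lambda_nPen(h)$ up to $o_P(n^{-1})$ over $\mathcal A_{k(n)}$ and over $\mathcal A_{k(n)}^R$, respectively. Assume that $Pen(\widehat h_n)\le M_0$ and $\widehat\alpha_n^R\in\mathcal N_{osn}$ with probability approaching one; $\widehat Q_n(\Pi_n\boldsymbol\alpha_n)\le c_0Q_n(\Pi_n\boldsymbol\alpha_n)+O_P(\delta_n^2)$; $\widehat Q_n(\alpha)\ge cQ_n(\alpha)-O_P(\bar\delta_n^2)$ uniformly over $\{\alpha\in\mathcal A_{k(n)}:Pen(h)\le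 M_0\}$ and $\widehat Q_n(\alpha)\ge c'Q_n(\alpha)-O_P(\delta_n^2)$ uniformly over $\mathcal A_{osn}$, for positive constants $c_0,c,c'$. Let $\mathbb Z_n=n^{-1}\sum_{i=1}^n dm(X_i,\alpha_0)[u_n^*]'\Sigma(X_i)^{-1}\rho(Z_i;\boldsymbol\alpha_n)$ with $\sqrt n\,\mathbb Z_n\Rightarrow N(0,1)$. For large $n$ let $\alpha+tu_n^*\in\mathcal A_{k(n)}$ for $(\alpha,t)\in\mathcal N_{osn}\times\mathcal T_n$, and for some $0\le e_n=o(n^{-1})$ and measurable $B_n=B_n(Z_1,\dots,Z_n)>0$ with $B_n=O_P(1)$ and $B_n-\|u_n^*\|^2=o_P(1)$ let, uniformly over $(\alpha,t)\in\mathcal N_{osn}\times\mathcal T_n$, $$\Big|\tfrac12\{\widehat Q_n(\alpha+tu_n^*)-\widehat Q_n(\alpha)\}-t\{\mathbb Z_n+\langle u_n^*,\alpha-\boldsymbol\alpha_n\rangle\}-\tfrac{B_n}2t^2\Big|=o_P(1)\cdot\max\{t^2,|t|n^{-1/2},e_n\}.$$ \textbf{Theorem.} Let $\widehat{QLR}_n(\phi_0)=n\{\widehat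 Q_n(\widehat\alpha_n^R)-\widehat Q_n(\widehat\alpha_n)\}$ (assumed to be a random variable). Then, under the local alternatives $\boldsymbol\alpha_n$: (1) if $d_n=n^{-1/2}\|v_n^*\|_{sd}$, then $\|u_n^*\|^2\,\widehat{QLR}_n(\phi_0)\Rightarrow\chi_1^2(\kappa^2)$, the law of $(N+\kappa)^2$ with $N$ standard normal; (2) if $n^{1/2}\|v_n^*\|_{sd}^{-1}d_n\to\infty$, then $\|u_n^*\|^2\,\widehat{QLR}_n(\phi_0)\to\infty$ in probability. The same holds for $n\{\inf_{\alpha\in\mathcal A^R_{k(n)}}\widehat Q_n(\alpha)-\widehat Q_n(\widehat\alpha_n)\}$, provided it is a random variable and $\widehat Q_n(\widehat\alpha_n^R)\le\widehat Q_n(\alpha)+o_P(n^{-1})$ uniformly over $\alpha\in\mathcal A^R_{k(n)}$. -/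

import Mathlib

open MeasureTheory ProbabilityTheory Filter Topology
open scoped ENNReal NNReal Matrix

namespace PSMD

/-! ### Stochastic order symbols

Along a sequence of probability spaces, events are measured with the (outer) measure, so that
no measurability of suprema or of estimators is needed. -/

section Orders

variable {Ω : ℕ → Type*} [∀ n, MeasurableSpace (Ω n)]

/-- The event `E n` has probability tending to zero. -/
def VanishingProb (μ : ∀ n, Measure (Ω n)) (E : ∀ n, Set (Ω n)) : Prop :=
  Tendsto (fun n => μ n (E n)) atTop (𝓝 0)

/-- The event `E n` occurs with probability approaching one. -/
def Wpa1 (μ : ∀ n, Measure (Ω n)) (E : ∀ n, Set (Ω n)) : Prop :=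
  VanishingProb μ fun n => (E n)ᶜ

/-- `X n = o_P(r n)`. -/
def LittleOP (μ : ∀ n, Measure (Ω n)) (X : ∀ n, Ω n → ℝ) (r : ℕ → ℝ) : Prop :=
  ∀ ε : ℝ, 0 < ε → VanishingProb μ fun n => {z | ε * r n < |X n z|}

/-- `X n = O_P(r n)`. -/
def BigOP (μ : ∀ n, Measure (Ω n)) (X : ∀ n, Ω n → ℝ) (r : ℕ → ℝ) : Prop :=
  ∀ η : ℝ, 0 < η → ∃ C : ℝ, ∀ᶠ n in atTop, μ n {z | C * r n < |X n z|} ≤ ENNReal.ofReal η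

/-- `X n i ≤ Y n i + O_P(r n)` uniformly over the indices `i ∈ S n`. -/
def UnifLeAddBigOP {I : Type*} (μ : ∀ n, Measure (Ω n)) (S : ℕ → Set I)
    (X Y : ∀ n, Ω n → I → ℝ) (r : ℕ → ℝ) : Prop :=
  ∀ η : ℝ, 0 < η → ∃ C : ℝ, ∀ᶠ n in atTop,
    μ n {z | ∃ i ∈ S n, Y n z i + C * r n < X n z i} ≤ ENNReal.ofReal η

/-- `X n → +∞` in probability. -/
def TendstoInfInProb (μ : ∀ n, Measure (Ω n)) (X : ∀ n, Ω n → ℝ) : Prop :=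
  ∀ K : ℝ, VanishingProb μ fun n => {z | X n z ≤ K}

end Orders

/-- The noncentral chi-square law with one degree of freedom and noncentrality parameter `l`:
the law of `W ^ 2` for `W` normal with mean `√l` and variance one. -/
noncomputable def noncentralChiSqOne (l : ℝ) : Measure ℝ :=
  (gaussianReal (Real.sqrt l) 1).map fun w => w ^ 2

instance (l : ℝ) : IsProbabilityMeasure (noncentralChiSqOne l) :=
  Measure.isProbabilityMeasure_map (by fun_prop)

/-- The parameter `α = (θ, h)`. -/
abbrev Param (dθ : ℕ) (H : Type*) : Type _ := EuclideanSpace ℝ (Fin dθ) × H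

/-- The strong norm `‖θ‖_e + ‖h‖_H`. -/
noncomputable def strongNorm {dθ : ℕ} {H : Type*} [NormedAddCommGroup H] (v : Param dθ H) : ℝ :=
  ‖v.1‖ + ‖v.2‖

/-- The law of the sample `Z_1, …, Z_n` of i.i.d. draws from `P n`. -/
noncomputable def sampleLaw {𝒵 : Type*} [MeasurableSpace 𝒵] (P : ℕ → ProbabilityMeasure 𝒵)
    (n : ℕ) : Measure (Fin n → 𝒵) :=
  Measure.pi fun _ => (P n : Measure 𝒵)

instance {𝒵 : Type*} [MeasurableSpace 𝒵] (P : ℕ → ProbabilityMeasure 𝒵) (n : ℕ) :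
    IsProbabilityMeasure (sampleLaw P n) := by
  unfold sampleLaw
  infer_instance

/-! ### The data of the problem -/

/-- The semi/nonparametric conditional moment model `E[ρ(Y, X; α₀) | X] = 0`; an observation is
`z = (x, y)`. -/
structure Model (𝒳 𝒴 : Type*) [MeasurableSpace 𝒳] [MeasurableSpace 𝒴] (dθ dρ : ℕ)
    (H : Type*) where
  /-- the residual function -/
  rho : 𝒳 × 𝒴 → Param dθ H → Fin dρ → ℝ
  /-- the finite dimensional parameter space -/
  Theta : Set (EuclideanSpace ℝ (Fin dθ))
  /-- the weighting matrix `Σ(x)` -/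
  wt : 𝒳 → Matrix (Fin dρ) (Fin dρ) ℝ
  /-- the reference parameter `α₀ = (θ₀, h₀)` -/
  alpha0 : Param dθ H
  /-- the law of an observation at `α₀` -/
  P0 : ProbabilityMeasure (𝒳 × 𝒴)
  /-- the functional of interest -/
  phi : Param dθ H → ℝ

/-- The sieves, the penalty and the tuning sequences. -/
structure Design (𝒳 𝒴 : Type*) [MeasurableSpace 𝒳] [MeasurableSpace 𝒴] (dθ dρ : ℕ)
    (H : Type*) [NormedAddCommGroup H] [NormedSpace ℝ H] extends Model 𝒳 𝒴 dθ dρ H where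
  /-- the sieve spaces `H_k` -/
  sieve : ℕ → Submodule ℝ H
  /-- the sieve index `k(n)` -/
  k : ℕ → ℕ
  /-- the sieve approximation `Π_n` -/
  proj : ℕ → H → H
  /-- the penalty -/
  Pen : H → ℝ≥0∞
  /-- the penalty weights `λ_n` -/
  lam : ℕ → ℝ
  /-- the rate `δ_n` -/
  del : ℕ → ℝ
  /-- the rate of the sample criterion on the whole sieve space -/
  delbar : ℕ → ℝ
  /-- the bound `M₀` -/
  M0 : ℝ≥0
  /-- the convex neighbourhood of `α₀` -/
  Aos : Set (Param dθ H)

/-- A local curve `α_n = α₀ + d_n Δ_n`, and the law `P_n` of an observation at `α_n`. -/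
structure LocalCurve (𝒳 𝒴 : Type*) [MeasurableSpace 𝒳] [MeasurableSpace 𝒴] (dθ : ℕ)
    (H : Type*) where
  d : ℕ → ℝ
  Delta : ℕ → Param dθ H
  P : ℕ → ProbabilityMeasure (𝒳 × 𝒴)

/-- The estimators `m̂` and `Σ̂`, and the unrestricted and restricted estimators of `α`. -/
structure Procedure (𝒳 𝒴 : Type*) (dθ dρ : ℕ) (H : Type*) where
  mhat : ∀ n, (Fin n → 𝒳 × 𝒴) → 𝒳 → Param dθ H → Fin dρ → ℝ
  wthat : ∀ n, (Fin n → 𝒳 × 𝒴) → 𝒳 → Matrix (Fin dρ) (Fin dρ) ℝ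
  est : ∀ n, (Fin n → 𝒳 × 𝒴) → Param dθ H
  estR : ∀ n, (Fin n → 𝒳 × 𝒴) → Param dθ H

noncomputable section

variable {𝒳 𝒴 H : Type*} [MeasurableSpace 𝒳] [MeasurableSpace 𝒴] [StandardBorelSpace 𝒴]
  [Nonempty 𝒴] {dθ dρ : ℕ} [NormedAddCommGroup H] [NormedSpace ℝ H]

/-! ### Population objects -/

namespace Model

variable (M : Model 𝒳 𝒴 dθ dρ H)

/-- The parameter space `A = Θ × H`. -/
def A : Set (Param dθ H) := {α | α.1 ∈ M.Theta}

/-- The marginal law of `X` under `P`. -/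
def lawX (P : ProbabilityMeasure (𝒳 × 𝒴)) : Measure 𝒳 := (P : Measure (𝒳 × 𝒴)).fst

/-- `m(x, α) = E[ρ(Y, X; α) | X = x]`, the conditional law being that of `P`. -/
def condMean (P : ProbabilityMeasure (𝒳 × 𝒴)) (α : Param dθ H) (x : 𝒳) : Fin dρ → ℝ :=
  fun j => ∫ y, M.rho (x, y) α j ∂((P : Measure (𝒳 × 𝒴)).condKernel x)

/-- `m(x, α)' Σ(x)⁻¹ m(x, α)`. -/
def critIntegrand (P : ProbabilityMeasure (𝒳 × 𝒴)) (α : Param dθ H) (x : 𝒳) : ℝ :=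
  M.condMean P α x ⬝ᵥ ((M.wt x)⁻¹ *ᵥ M.condMean P α x)

/-- The population criterion `Q(α) = E[m(X, α)' Σ(X)⁻¹ m(X, α)]` under `P`. -/
def Q (P : ProbabilityMeasure (𝒳 × 𝒴)) (α : Param dθ H) : ℝ :=
  ∫ x, M.critIntegrand P α x ∂(lawX P)

/-- `Σ₀(x) = Var(ρ(Y, X; α₀) | X = x)` at the reference law. -/
def Sigma0 (x : 𝒳) : Matrix (Fin dρ) (Fin dρ) ℝ := fun i j =>
  ∫ y, (M.rho (x, y) M.alpha0 i - M.condMean M.P0 M.alpha0 x i) *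
    (M.rho (x, y) M.alpha0 j - M.condMean M.P0 M.alpha0 x j)
    ∂((M.P0 : Measure (𝒳 × 𝒴)).condKernel x)

/-- The pathwise derivative `dm(x, α₀)/dα [v]`. -/
def dm (v : Param dθ H) (x : 𝒳) : Fin dρ → ℝ :=
  fun j => deriv (fun τ : ℝ => M.condMean M.P0 (M.alpha0 + τ • v) x j) 0

/-- `⟨v, w⟩ = E[(dm(X, α₀)/dα [v])' Σ(X)⁻¹ (dm(X, α₀)/dα [w])]`. -/
def weakInner (v w : Param dθ H) : ℝ :=
  ∫ x, M.dm v x ⬝ᵥ ((M.wt x)⁻¹ *ᵥ M.dm w x) ∂(lawX M.P0)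

/-- The weak norm `‖v‖ = ⟨v, v⟩^{1/2}`. -/
def weakNorm (v : Param dθ H) : ℝ := Real.sqrt (M.weakInner v v)

/-- `(dm(x, α₀)/dα [v])' Σ(x)⁻¹ ρ(z, α)`. -/
def score (v α : Param dθ H) (z : 𝒳 × 𝒴) : ℝ :=
  M.dm v z.1 ⬝ᵥ ((M.wt z.1)⁻¹ *ᵥ M.rho z α)

/-- `‖v‖_sd`, the standard deviation of the score in the direction `v` at `α₀`. -/
def sdNorm (v : Param dθ H) : ℝ :=
  Real.sqrt (variance (M.score v M.alpha0) (M.P0 : Measure (𝒳 × 𝒴)))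

/-- The pathwise derivative `dφ(α₀)/dα [v]`. -/
def dphi (v : Param dθ H) : ℝ := deriv (fun τ : ℝ => M.phi (M.alpha0 + τ • v)) 0

/-- The scaled representer `u = v / ‖v‖_sd`. -/
def scaled (v : Param dθ H) : Param dθ H := (M.sdNorm v)⁻¹ • v

/-- Under the law `P`, the conditional moments exist and the conditional moment restrictions
identify `a`. -/
structure IdentifiedAt (P : ProbabilityMeasure (𝒳 × 𝒴)) (a : Param dθ H) : Prop where
  integrable_rho : ∀ α ∈ M.A, ∀ j, Integrable (fun z => M.rho z α j) (P : Measure (𝒳 × 𝒴))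
  integrable_crit : ∀ α ∈ M.A, Integrable (M.critIntegrand P α) (lawX P)
  identified : ∀ α ∈ M.A, (∀ᵐ x ∂(lawX P), M.condMean P α x = 0) ↔ α = a

end Model

/-! ### Sieve objects -/

namespace Design

variable (D : Design 𝒳 𝒴 dθ dρ H)

/-- The sieve space `A_{k(n)} = Θ × H_{k(n)}`. -/
def Ak (n : ℕ) : Set (Param dθ H) := {α | α.1 ∈ D.Theta ∧ α.2 ∈ D.sieve (D.k n)}

/-- `A_{k(n)}^{M₀}`. -/
def AkM (n : ℕ) : Set (Param dθ H) := {α ∈ D.Ak n | D.Pen α.2 ≤ D.M0}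

/-- `A_osn = A_os ∩ A_{k(n)}`. -/
def Aosn (n : ℕ) : Set (Param dθ H) := D.Aos ∩ D.Ak n

/-- `Π_n α = (θ, Π_n h)`. -/
def projA (n : ℕ) (α : Param dθ H) : Param dθ H := (α.1, D.proj n α.2)

/-- `V`, the linear span of `A_os - {α₀}`. -/
def V : Submodule ℝ (Param dθ H) := Submodule.span ℝ ((fun α => α - D.alpha0) '' D.Aos)

/-- The sieve tangent space `ℝ^{dθ} × H_{k(n)}`. -/
def Vn (n : ℕ) : Submodule ℝ (Param dθ H) :=
  (⊤ : Submodule ℝ (EuclideanSpace ℝ (Fin dθ))).prod (D.sieve (D.k n))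

/-- The sieve measure of local ill-posedness `τ_n`. -/
def tau (n : ℕ) : ℝ :=
  sSup {r | ∃ α ∈ D.Aosn n, D.weakNorm (α - D.projA n D.alpha0) ≠ 0 ∧
    r = strongNorm (α - D.projA n D.alpha0) / D.weakNorm (α - D.projA n D.alpha0)}

/-- `δ_{s,n} = ‖h₀ - Π_n h₀‖ + τ_n δ_n`. -/
def delS (n : ℕ) : ℝ := ‖D.alpha0.2 - D.proj n D.alpha0.2‖ + D.tau n * D.del n

/-- `M_n = min {log log (n + 1), log (δ_{s,n}⁻¹ + 1)}`. -/
def Mn (n : ℕ) : ℝ :=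
  min (Real.log (Real.log ((n : ℝ) + 1))) (Real.log ((D.delS n)⁻¹ + 1))

/-- The local parameter space `N_os`. -/
def Nos (n : ℕ) : Set (Param dθ H) :=
  {α ∈ D.A | D.weakNorm (α - D.alpha0) ≤ D.Mn n * D.del n ∧
    strongNorm (α - D.alpha0) ≤ D.Mn n * D.delS n ∧ D.Pen α.2 ≤ D.M0}

/-- `N_osn = N_os ∩ A_{k(n)}`. -/
def Nosn (n : ℕ) : Set (Param dθ H) := D.Nos n ∩ D.Ak n

/-- `T_n = {t : |t| ≤ 4 M_n² δ_n}`. -/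
def T (n : ℕ) : Set ℝ := {t | |t| ≤ 4 * D.Mn n ^ 2 * D.del n}

/-- The restricted sieve space `{α ∈ A_{k(n)} : φ(α) = φ₀}`. -/
def AkR (phi0 : ℝ) (n : ℕ) : Set (Param dθ H) := {α ∈ D.Ak n | D.phi α = phi0}

/-- `v n` is the sieve Riesz representer of `dφ(α₀)/dα` on `ℝ^{dθ} × H_{k(n)}`. -/
def IsSieveRiesz (v : ℕ → Param dθ H) : Prop :=
  ∀ n, v n ∈ D.Vn n ∧ ∀ w ∈ D.Vn n, D.dphi w = D.weakInner (v n) w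

/-- `a n` minimizes `‖α - α₀‖` over `ℝ^{dθ} × H_{k(n)}`. -/
def IsWeakProjection (a : ℕ → Param dθ H) : Prop :=
  ∀ n, a n ∈ D.Vn n ∧ ∀ α ∈ D.Vn n, D.weakNorm (a n - D.alpha0) ≤ D.weakNorm (α - D.alpha0)

/-- The point `α_n = α₀ + d_n Δ_n` of the local curve. -/
def point (C : LocalCurve 𝒳 𝒴 dθ H) (n : ℕ) : Param dθ H := D.alpha0 + C.d n • C.Delta n

/-! ### Conditions on the model at `α₀` -/

/-- Identification, sieves and weighting at `α₀`. -/
structure BasicConditions : Prop where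
  measurable_rho : ∀ α ∈ D.A, Measurable fun z => D.rho z α
  measurable_wt : ∀ i j, Measurable fun x => D.wt x i j
  wt_symm : ∀ x, (D.wt x).IsSymm
  wt_bounds : ∃ c C : ℝ, 0 < c ∧ ∀ x w,
    c * (w ⬝ᵥ w) ≤ w ⬝ᵥ (D.wt x *ᵥ w) ∧ w ⬝ᵥ (D.wt x *ᵥ w) ≤ C * (w ⬝ᵥ w)
  memLp_rho : ∀ j, MemLp (fun z => D.rho z D.alpha0 j) 2 (D.P0 : Measure (𝒳 × 𝒴))
  Sigma0_bounds : ∃ c C : ℝ, 0 < c ∧ ∀ᵐ x ∂(Model.lawX D.P0), ∀ w,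
    c * (w ⬝ᵥ w) ≤ w ⬝ᵥ (D.Sigma0 x *ᵥ w) ∧ w ⬝ᵥ (D.Sigma0 x *ᵥ w) ≤ C * (w ⬝ᵥ w)
  identified : D.IdentifiedAt D.P0 D.alpha0
  isCompact_Theta : IsCompact D.Theta
  theta0_mem : D.alpha0.1 ∈ interior D.Theta
  sieve_mono : Monotone D.sieve
  sieve_finite : ∀ j, FiniteDimensional ℝ (D.sieve j)
  sieve_dense : Dense (⋃ j, (D.sieve j : Set H))
  k_tendsto : Tendsto D.k atTop atTop
  proj_mem : ∀ n h, D.proj n h ∈ D.sieve (D.k n)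
  proj_tendsto : Tendsto (fun n => ‖D.proj n D.alpha0.2 - D.alpha0.2‖) atTop (𝓝 0)

/-- Penalty and rates. -/
structure RateConditions : Prop where
  lam_pos : ∀ n, 0 < D.lam n
  Pen_lsc : ∀ K : ℝ≥0, IsCompact {h | D.Pen h ≤ K}
  Pen_proj : ∀ᶠ n in atTop, D.Pen (D.proj n D.alpha0.2) ≤ D.M0
  del_pos : ∀ n, 0 < D.del n
  del_tendsto : Tendsto D.del atTop (𝓝 0)
  del_le : ∀ n, D.del n ≤ D.delbar n
  delbar_tendsto : Tendsto D.delbar atTop (𝓝 0)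
  inv_le : ∃ C : ℝ, ∀ᶠ n : ℕ in atTop, 1 / (n : ℝ) ≤ C * D.del n ^ 2
  lam_le : ∀ᶠ n in atTop, D.lam n ≤ D.del n ^ 2
  Q_proj_le : ∀ᶠ n in atTop, D.Q D.P0 (D.projA n D.alpha0) ≤ D.del n ^ 2
  delS_pos : ∀ᶠ n in atTop, 0 < D.delS n
  delS_tendsto : Tendsto D.delS atTop (𝓝 0)

/-- The neighbourhood `A_os`, differentiability of `m` at `α₀` and local curvature. -/
structure LocalConditions : Prop where
  convex_Aos : Convex ℝ D.Aos
  alpha0_mem : D.alpha0 ∈ D.Aos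
  Aos_subset : ∀ α ∈ D.Aos, α ∈ D.A ∧ strongNorm (α - D.alpha0) < D.M0 ∧ D.Pen α.2 ≤ D.M0
  Aos_nhd : ∃ r : ℝ, 0 < r ∧ ∀ α ∈ D.A, strongNorm (α - D.alpha0) < r → D.Pen α.2 ≤ D.M0 →
    α ∈ D.Aos
  differentiable : ∀ v ∈ D.V, ∀ᵐ x ∂(Model.lawX D.P0), ∀ j,
    DifferentiableAt ℝ (fun τ : ℝ => D.condMean D.P0 (D.alpha0 + τ • v) x j) 0
  linear : ∀ v ∈ D.V, ∀ w ∈ D.V, ∀ a b : ℝ, ∀ᵐ x ∂(Model.lawX D.P0),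
    D.dm (a • v + b • w) x = a • D.dm v x + b • D.dm w x
  memLp_dm : ∀ v ∈ D.V, ∀ j, MemLp (fun x => D.dm v x j) 2 (Model.lawX D.P0)
  weak_le_strong : ∃ C : ℝ, ∀ α ∈ D.Aos,
    D.weakNorm (α - D.alpha0) ≤ C * strongNorm (α - D.alpha0)
  curvature : ∃ c C : ℝ, 0 < c ∧ ∀ α ∈ D.Aos,
    c * D.weakNorm (α - D.alpha0) ^ 2 ≤ D.Q D.P0 α ∧
      D.Q D.P0 α ≤ C * D.weakNorm (α - D.alpha0) ^ 2
  Vn_le : ∀ n, D.Vn n ≤ D.V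
  weakNorm_ne : ∀ n, ∀ v ∈ D.Vn n, v ≠ 0 → D.weakNorm v ≠ 0

/-- The difference of penalties is of smaller order than `1 / n`, uniformly over `A_os` and the
local perturbations `α + t u_n`. -/
def PenaltyNegligible (v : ℕ → Param dθ H) : Prop :=
  ∀ ε : ℝ, 0 < ε → ∀ᶠ n : ℕ in atTop,
    ∀ α ∈ D.Aos ∪ {β | ∃ γ ∈ D.Nosn n, ∃ t ∈ D.T n, β = γ + t • D.scaled (v n)},
    ∀ α' ∈ D.Aos ∪ {β | ∃ γ ∈ D.Nosn n, ∃ t ∈ D.T n, β = γ + t • D.scaled (v n)},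
      ENNReal.ofReal (D.lam n) * D.Pen α.2 ≤
        ENNReal.ofReal (D.lam n) * D.Pen α'.2 + ENNReal.ofReal (ε / n)

/-- Local behaviour of the functional `φ` at `α₀`. -/
structure FunctionalConditions (v a : ℕ → Param dθ H) : Prop where
  continuous_phi : Continuous D.phi
  derivative : ∃ L : Param dθ H →L[ℝ] ℝ, ∀ w,
    HasDerivAt (fun τ : ℝ => D.phi (D.alpha0 + τ • w)) (L w) 0
  nonzero : ∃ w ∈ D.V, D.dphi w ≠ 0
  norm_riesz : Tendsto (fun n : ℕ => D.weakNorm (v n) / Real.sqrt n) atTop (𝓝 0)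
  nonlinearity : ∀ ε : ℝ, 0 < ε → ∀ᶠ n : ℕ in atTop, ∀ α ∈ D.Nosn n, ∀ t ∈ D.T n,
    Real.sqrt n * |D.phi (α + t • D.scaled (v n)) - D.phi D.alpha0 -
      D.dphi (α + t • D.scaled (v n) - D.alpha0)| ≤ ε * D.weakNorm (v n)
  bias : ∀ ε : ℝ, 0 < ε → ∀ᶠ n : ℕ in atTop,
    Real.sqrt n * |D.dphi (a n - D.alpha0)| ≤ ε * D.weakNorm (v n)

/-! ### Conditions along the local curve -/

/-- The local curve stays in the local parameter space, and the law `P n` is generated by the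
model at `α_n`, with the population conditions holding uniformly along the curve. -/
structure CurveConditions (C : LocalCurve 𝒳 𝒴 dθ H) (κ : ℝ) : Prop where
  d_nonneg : ∀ n, 0 ≤ C.d n
  Delta_mem : ∀ n, C.Delta n ∈ D.Vn n
  kappa_ne : κ ≠ 0
  dphi_tendsto : Tendsto (fun n => D.dphi (C.Delta n)) atTop (𝓝 κ)
  weak_bound : ∃ c : ℝ, c < 1 ∧ ∀ᶠ n in atTop,
    C.d n * D.weakNorm (C.Delta n) ≤ c * (D.Mn n * D.del n)
  strong_bound : ∀ᶠ n in atTop, C.d n * strongNorm (C.Delta n) ≤ D.Mn n * D.delS n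
  mem_Nos : ∀ᶠ n in atTop, D.point C n ∈ D.Nos n
  identified : ∀ n, D.IdentifiedAt (C.P n) (D.point C n)
  lsc : ∀ α ∈ D.A, ∀ b < D.Q D.P0 α, ∃ r : ℝ, 0 < r ∧ ∀ᶠ n in atTop, ∀ α' ∈ D.A,
    strongNorm (α' - α) < r → b < D.Q (C.P n) α'
  curvature : ∃ c K : ℝ, 0 < c ∧ ∀ᶠ n in atTop, ∀ α ∈ D.Aos,
    c * D.weakNorm (α - D.point C n) ^ 2 ≤ D.Q (C.P n) α ∧
      D.Q (C.P n) α ≤ K * D.weakNorm (α - D.point C n) ^ 2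
  proj_tendsto :
    Tendsto (fun n => ‖D.proj n (D.point C n).2 - (D.point C n).2‖) atTop (𝓝 0)
  Pen_proj : ∀ᶠ n in atTop, D.Pen (D.proj n (D.point C n).2) ≤ D.M0
  Q_proj_le : ∀ᶠ n in atTop, D.Q (C.P n) (D.projA n (D.point C n)) ≤ D.del n ^ 2

/-! ### Sample objects -/

/-- The sample criterion `Q̂_n(α)`. -/
def Qhat (R : Procedure 𝒳 𝒴 dθ dρ H) (n : ℕ) (z : Fin n → 𝒳 × 𝒴) (α : Param dθ H) : ℝ :=
  (n : ℝ)⁻¹ * ∑ i, R.mhat n z (z i).1 α ⬝ᵥ ((R.wthat n z (z i).1)⁻¹ *ᵥ R.mhat n z (z i).1 α)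

/-- The penalized sample criterion `Q̂_n(α) + λ_n Pen(h)`. -/
def penCrit (R : Procedure 𝒳 𝒴 dθ dρ H) (n : ℕ) (z : Fin n → 𝒳 × 𝒴) (α : Param dθ H) : EReal :=
  ((Qhat R n z α : ℝ) : EReal) + ((ENNReal.ofReal (D.lam n) * D.Pen α.2 : ℝ≥0∞) : EReal)

/-- `a n` belongs to `S n` and minimizes the penalized criterion over `S n` up to
`o_P(1 / n)`. -/
def IsApproxMinimizer (C : LocalCurve 𝒳 𝒴 dθ H) (R : Procedure 𝒳 𝒴 dθ dρ H)
    (S : ℕ → Set (Param dθ H)) (a : ∀ n, (Fin n → 𝒳 × 𝒴) → Param dθ H) : Prop :=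
  (∀ᶠ n in atTop, ∀ z, a n z ∈ S n) ∧
  ∀ ε : ℝ, 0 < ε → VanishingProb (sampleLaw C.P) fun n =>
    {z | ∃ α ∈ S n, D.penCrit R n z α + ((ε / n : ℝ) : EReal) < D.penCrit R n z (a n z)}

/-- `Z_n(α_n) = n⁻¹ ∑ (dm(X_i, α₀)/dα [u_n])' Σ(X_i)⁻¹ ρ(Z_i, α_n)`. -/
def scoreAvg (C : LocalCurve 𝒳 𝒴 dθ H) (v : ℕ → Param dθ H) (n : ℕ) (z : Fin n → 𝒳 × 𝒴) : ℝ :=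
  (n : ℝ)⁻¹ * ∑ i, D.score (D.scaled (v n)) (D.point C n) (z i)

/-- Conditions on the sample criterion and on the estimators, under the laws `P n`. -/
structure SampleConditions (C : LocalCurve 𝒳 𝒴 dθ H) (R : Procedure 𝒳 𝒴 dθ dρ H)
    (phi0 : ℝ) : Prop where
  est_min : D.IsApproxMinimizer C R D.Ak R.est
  estR_min : D.IsApproxMinimizer C R (D.AkR phi0) R.estR
  est_Pen : Wpa1 (sampleLaw C.P) fun n => {z | D.Pen (R.est n z).2 ≤ D.M0}
  estR_mem : Wpa1 (sampleLaw C.P) fun n => {z | R.estR n z ∈ D.Nosn n}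
  upper : ∃ c0 : ℝ, 0 < c0 ∧ UnifLeAddBigOP (sampleLaw C.P)
    (fun n => {D.projA n (D.point C n)}) (fun n z α => Qhat R n z α)
    (fun n _ α => c0 * D.Q (C.P n) α) (fun n => D.del n ^ 2)
  lower_global : ∃ c : ℝ, 0 < c ∧ UnifLeAddBigOP (sampleLaw C.P) D.AkM
    (fun n _ α => c * D.Q (C.P n) α) (fun n z α => Qhat R n z α) (fun n => D.delbar n ^ 2)
  lower_local : ∃ c : ℝ, 0 < c ∧ UnifLeAddBigOP (sampleLaw C.P) D.Aosn
    (fun n _ α => c * D.Q (C.P n) α) (fun n z α => Qhat R n z α) (fun n => D.del n ^ 2)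

/-- Local quadratic approximation of the sample criterion, centred at `α_n` and under `P n`. -/
structure LocalQuadratic (C : LocalCurve 𝒳 𝒴 dθ H) (R : Procedure 𝒳 𝒴 dθ dρ H)
    (v : ℕ → Param dθ H) (B : ∀ n, (Fin n → 𝒳 × 𝒴) → ℝ) : Prop where
  path_mem : ∀ᶠ n in atTop, ∀ α ∈ D.Nosn n, ∀ t ∈ D.T n, α + t • D.scaled (v n) ∈ D.Ak n
  expansion : ∃ e : ℕ → ℝ, (∀ n, 0 ≤ e n) ∧ Tendsto (fun n : ℕ => (n : ℝ) * e n) atTop (𝓝 0) ∧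
    ∀ ε : ℝ, 0 < ε → VanishingProb (sampleLaw C.P) fun n =>
      {z | ∃ α ∈ D.Nosn n, ∃ t ∈ D.T n,
        ε * max (t ^ 2) (max (|t| / Real.sqrt n) (e n)) <
          |(Qhat R n z (α + t • D.scaled (v n)) - Qhat R n z α) / 2
            - t * (D.scoreAvg C v n z + D.weakInner (D.scaled (v n)) (α - D.point C n))
            - B n z / 2 * t ^ 2|}
  B_measurable : ∀ n, Measurable (B n)
  B_pos : ∀ n z, 0 < B n z
  B_bounded : BigOP (sampleLaw C.P) B fun _ => 1
  B_approx : LittleOP (sampleLaw C.P) (fun n z => B n z - D.weakNorm (D.scaled (v n)) ^ 2)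
    fun _ => 1
  clt : TendstoInDistribution (fun (n : ℕ) z => Real.sqrt n * D.scoreAvg C v n z) atTop id
    (sampleLaw C.P) (gaussianReal 0 1)

/-- The sieve quasi likelihood ratio statistic `n (Q̂_n(α̂_n^R) - Q̂_n(α̂_n))`. -/
def sqlr (R : Procedure 𝒳 𝒴 dθ dρ H) (n : ℕ) (z : Fin n → 𝒳 × 𝒴) : ℝ :=
  n * (Qhat R n z (R.estR n z) - Qhat R n z (R.est n z))

/-- The statistic with the exact infimum of the criterion over the restricted sieve space. -/
def sqlrInf (R : Procedure 𝒳 𝒴 dθ dρ H) (phi0 : ℝ) (n : ℕ) (z : Fin n → 𝒳 × 𝒴) : ℝ :=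
  n * (sInf (Qhat R n z '' D.AkR phi0 n) - Qhat R n z (R.est n z))

end Design

/-- The asymptotic behaviour, under the local alternatives, of a statistic `S n` scaled by
`‖u_n‖²`: (1) noncentral chi-square limit along `d n = n^{-1/2} ‖v_n‖_sd`; (2) divergence in
probability when `n^{1/2} d n / ‖v_n‖_sd → ∞`. -/
def LocalAsymptotics (D : Design 𝒳 𝒴 dθ dρ H) (C : LocalCurve 𝒳 𝒴 dθ H)
    (v : ℕ → Param dθ H) (κ : ℝ) (S : ∀ n, (Fin n → 𝒳 × 𝒴) → ℝ) : Prop :=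
  ((∀ᶠ n : ℕ in atTop, C.d n = D.sdNorm (v n) / Real.sqrt n) →
    TendstoInDistribution (fun n z => D.weakNorm (D.scaled (v n)) ^ 2 * S n z) atTop id
      (sampleLaw C.P) (noncentralChiSqOne (κ ^ 2))) ∧
  (Tendsto (fun n : ℕ => Real.sqrt n * C.d n / D.sdNorm (v n)) atTop atTop →
    TendstoInfInProb (sampleLaw C.P) fun n z => D.weakNorm (D.scaled (v n)) ^ 2 * S n z)

end

end PSMD

/-! Everything happens in one direction, that of `u_n`. If a local parameter `α` moves by `s
n^{-1/2} u_n`, then `n Q̂_n` changes by `2 s (√n Z_n + √n⟨u_n, α - α₀⟩ - drift_n) + B_n s²`, up to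
`o_P(s² + 1)`. Here `drift_n = √n d_n ⟨u_n, Δ_n⟩ = √n d_n dφ(Δ_n) / ‖v_n‖_sd` appears because the
expansion is centred at the true parameter `α_n` instead of `α₀`. In the same coordinate the
functional is linear: `√n (φ - φ₀) / ‖v_n‖_sd` is close to `√n⟨u_n, α - α₀⟩ + s ‖u_n‖²`. The null
hypothesis therefore forces `√n⟨u_n, α - α₀⟩ ≈ 0` at the restricted estimator, and minimality forces
the linear coefficient to vanish at the unrestricted one.

Two comparisons pin down the statistic. Stepping from the restricted estimator by the minimizing `s`
of the quadratic bounds `‖u_n‖² QLR` below by about `(√n Z_n - drift_n)²`. Stepping from the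
unrestricted estimator until the path meets the null, which it does by the intermediate value
theorem, bounds it above by the same quantity. When `drift_n → κ`, the central limit theorem and
Slutsky's theorem give the law of `(N - κ)²`, which is that of `(N + κ)²` (`tendsto_sqlr_sub_sq`).
When the drift diverges, a unit step from the restricted estimator already shows divergence
(`tendsto_sqlr_atTop`).

Three facts prepare this. The weak norm and the standard deviation norm are equivalent, so `‖u_n‖`
stays away from `0` and `∞` (`exists_sdNorm_bounds`). The unrestricted estimator reaches the local
parameter space, by consistency and then a rate argument under `P_n` (`eventually_est_mem_Nosn`).
Every local parameter can be moved into the null within `T_n` (`exists_path_null`). Statements with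
probability approaching one are handled as eventual statements along the filter `probFilter`. -/

namespace PSMD

/-! ### Stochastic orders as statements along a filter -/

section ProbFilter

variable {Ω : ℕ → Type*} [∀ n, MeasurableSpace (Ω n)]

/-- The filter of events with probability approaching one. -/
def probFilter (μ : ∀ n, Measure (Ω n)) : Filter (Σ n, Ω n) where
  sets := {S | Wpa1 μ fun n => {z | ⟨n, z⟩ ∈ S}}
  univ_sets := by simp [Wpa1, VanishingProb]
  sets_of_superset {S T} hS hST := by
    refine tendsto_of_tendsto_of_tendsto_of_le_of_le tendsto_const_nhds hS (fun _ => zero_le)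
      fun n => measure_mono fun z hz hzS => hz (hST hzS)
  inter_sets {S T} hS hT := by
    have h := Tendsto.add hS hT
    rw [add_zero] at h
    refine tendsto_of_tendsto_of_tendsto_of_le_of_le tendsto_const_nhds h (fun _ => zero_le)
      fun n => (measure_mono ?_).trans (measure_union_le _ _)
    intro z hz
    by_cases h1 : (⟨n, z⟩ : Σ n, Ω n) ∈ S
    · exact Or.inr fun h2 => hz ⟨h1, h2⟩
    · exact Or.inl h1

variable {μ : ∀ n, Measure (Ω n)}

theorem eventually_probFilter {q : (Σ n, Ω n) → Prop} :
    (∀ᶠ p in probFilter μ, q p) ↔ VanishingProb μ fun n => {z | ¬ q ⟨n, z⟩} :=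
  Iff.rfl

theorem VanishingProb.eventually {E : ∀ n, Set (Ω n)} (h : VanishingProb μ E) :
    ∀ᶠ p in probFilter μ, p.2 ∉ E p.1 := by
  rw [eventually_probFilter]
  convert! h using 2 with n
  ext z
  simp

theorem Wpa1.eventually {E : ∀ n, Set (Ω n)} (h : Wpa1 μ E) :
    ∀ᶠ p in probFilter μ, p.2 ∈ E p.1 :=
  h

theorem VanishingProb.of_eventually {E : ∀ n, Set (Ω n)}
    (h : ∀ᶠ p in probFilter μ, p.2 ∉ E p.1) : VanishingProb μ E := by
  rw [eventually_probFilter] at h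
  convert! h using 2 with n
  ext z
  simp

theorem tendsto_fst_probFilter : Tendsto Sigma.fst (probFilter μ) atTop := by
  intro S hS
  refine tendsto_const_nhds.congr' (f₁ := fun _ => 0) ?_
  filter_upwards [hS] with n hn
  have : ({z : Ω n | (⟨n, z⟩ : Σ n, Ω n) ∈ Sigma.fst ⁻¹' S})ᶜ = ∅ := by
    ext z; simpa using hn
  simp only [this, measure_empty]

theorem eventually_probFilter_of_atTop {q : ℕ → Prop} (h : ∀ᶠ n in atTop, q n) :
    ∀ᶠ p in probFilter μ, q p.1 :=
  tendsto_fst_probFilter.eventually h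

/-- A criterion for an event to have probability approaching one. -/
theorem eventually_probFilter_of_forall {q : (Σ n, Ω n) → Prop}
    (h : ∀ η : ℝ, 0 < η → ∀ᶠ n in atTop, μ n {z | ¬ q ⟨n, z⟩} ≤ ENNReal.ofReal η) :
    ∀ᶠ p in probFilter μ, q p := by
  rw [eventually_probFilter, VanishingProb, ENNReal.tendsto_nhds_zero]
  intro ε hε
  by_cases hε' : ε = ∞
  · simp [hε']
  · have := h ε.toReal (ENNReal.toReal_pos hε.ne' hε')
    rwa [ENNReal.ofReal_toReal hε'] at this

/-- A deterministic sequence that diverges, however slowly, eventually exceeds the constant attached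
to each tolerance `η`. This removes the quantifiers over `η` and `C` from later arguments. -/
theorem BigOP.eventually {X : ∀ n, Ω n → ℝ} (h : BigOP μ X fun _ => 1) {a : ℕ → ℝ}
    (ha : Tendsto a atTop atTop) : ∀ᶠ p in probFilter μ, |X p.1 p.2| ≤ a p.1 := by
  refine eventually_probFilter_of_forall fun η hη => ?_
  obtain ⟨C, hC⟩ := h η hη
  filter_upwards [hC, ha.eventually_ge_atTop C] with n hn hCn
  refine (measure_mono fun z hz => ?_).trans hn
  simp only [not_le, Set.mem_ofPred_eq, mul_one] at hz ⊢
  linarith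

theorem UnifLeAddBigOP.eventually {I : Type*} {S : ℕ → Set I} {X Y : ∀ n, Ω n → I → ℝ}
    {r : ℕ → ℝ} (h : UnifLeAddBigOP μ S X Y r) (hr : ∀ n, 0 ≤ r n) {a : ℕ → ℝ}
    (ha : Tendsto a atTop atTop) :
    ∀ᶠ p in probFilter μ, ∀ i ∈ S p.1, X p.1 p.2 i ≤ Y p.1 p.2 i + a p.1 * r p.1 := by
  refine eventually_probFilter_of_forall fun η hη => ?_
  obtain ⟨C, hC⟩ := h η hη
  filter_upwards [hC, ha.eventually_ge_atTop C] with n hn hCn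
  refine (measure_mono fun z hz => ?_).trans hn
  simp only [not_forall, not_le, Set.mem_ofPred_eq] at hz ⊢
  obtain ⟨i, hi, hlt⟩ := hz
  exact ⟨i, hi, lt_of_le_of_lt (by gcongr; exact hr n) hlt⟩

theorem LittleOP.tendsto {X : ∀ n, Ω n → ℝ} (h : LittleOP μ X fun _ => 1) :
    Tendsto (fun p : Σ n, Ω n => X p.1 p.2) (probFilter μ) (𝓝 0) := by
  rw [Metric.tendsto_nhds]
  intro ε hε
  filter_upwards [(h (ε / 2) (by positivity)).eventually] with p hp
  simp only [not_lt] at hp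
  rw [Real.dist_eq, sub_zero]
  linarith

/-- Stochastic boundedness is not eventual boundedness along `probFilter`, since the constant
depends on the tolerated probability. Hence half of `η` is spent on the event that `Y` is large and
half on the failure of the little-o bound. -/
theorem tendsto_zero_of_isLittleO_sq {X : (Σ n, Ω n) → ℝ} {Y : ∀ n, Ω n → ℝ}
    (hX : X =o[probFilter μ] fun p => Y p.1 p.2 ^ 2 + 1) (hY : BigOP μ Y fun _ => 1) :
    Tendsto X (probFilter μ) (𝓝 0) := by
  rw [Metric.tendsto_nhds]
  intro ε hε
  refine eventually_probFilter_of_forall fun η hη => ?_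
  obtain ⟨C, hC⟩ := hY (η / 2) (by positivity)
  -- With this constant the little-o bound is at most `ε / 2` wherever `|Y| ≤ C`.
  have hpos : 0 < ε / (2 * (C ^ 2 + 1)) := by positivity
  have h1 := hX.bound hpos
  rw [eventually_probFilter, VanishingProb, ENNReal.tendsto_nhds_zero] at h1
  filter_upwards [hC, h1 (ENNReal.ofReal (η / 2)) (by simpa using hη)] with n hn hn'
  calc _ ≤ _ := measure_mono (t := _ ∪ _) fun z hz => ?_
    _ ≤ _ := measure_union_le _ _
    _ ≤ ENNReal.ofReal (η / 2) + ENNReal.ofReal (η / 2) := add_le_add hn hn'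
    _ = ENNReal.ofReal η := by rw [← ENNReal.ofReal_add (by positivity) (by positivity)]; simp
  simp only [Real.dist_eq, sub_zero, not_lt, Set.mem_ofPred_eq, Set.mem_union, mul_one, not_le,
    Real.norm_eq_abs] at hz ⊢
  by_contra hcon
  push Not at hcon
  obtain ⟨h2, h3⟩ := hcon
  have h4 : Y n z ^ 2 ≤ C ^ 2 := by
    rw [← sq_abs]; gcongr
  rw [abs_of_nonneg (by positivity : 0 ≤ Y n z ^ 2 + 1)] at h3
  have h5 : ε / (2 * (C ^ 2 + 1)) * (Y n z ^ 2 + 1) ≤ ε / (2 * (C ^ 2 + 1)) * (C ^ 2 + 1) := by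
    gcongr
  have h6 : ε / (2 * (C ^ 2 + 1)) * (C ^ 2 + 1) = ε / 2 := by field_simp
  linarith

theorem tendstoInfInProb_of_tendsto {X : ∀ n, Ω n → ℝ}
    (h : Tendsto (fun p : Σ n, Ω n => X p.1 p.2) (probFilter μ) atTop) :
    TendstoInfInProb μ X := by
  intro K
  refine VanishingProb.of_eventually ?_
  filter_upwards [h.eventually_gt_atTop K] with p hp
  simpa using hp

end ProbFilter

/-! ### Convergence in distribution on varying probability spaces -/

section Distribution

variable {Ω : ℕ → Type*} [∀ n, MeasurableSpace (Ω n)] {μ : ∀ n, Measure (Ω n)}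
  [∀ n, IsProbabilityMeasure (μ n)] {Ω' : Type*} [MeasurableSpace Ω'] {ν : Measure Ω'}
  [IsProbabilityMeasure ν] {X Y : ∀ n, Ω n → ℝ} {Z : Ω' → ℝ}

/-- Slutsky's theorem for random variables on a sequence of probability spaces. -/
theorem tendstoInDistribution_of_tendsto_sub (hX : TendstoInDistribution X atTop Z μ ν)
    (hXY : Tendsto (fun p : Σ n, Ω n => Y p.1 p.2 - X p.1 p.2) (probFilter μ) (𝓝 0))
    (hY : ∀ n, AEMeasurable (Y n) (μ n)) : TendstoInDistribution Y atTop Z μ ν := by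
  -- All variables are carried to the infinite product space through its coordinates. Convergence in
  -- distribution sees only the individual laws, and `Y n - X n` depends on the single coordinate
  -- `n`, so Slutsky's theorem on one space applies.
  have hmp := measurePreserving_eval_infinitePi μ
  have hmap : ∀ {W : ∀ n, Ω n → ℝ}, (∀ n, AEMeasurable (W n) (μ n)) → ∀ n,
      (Measure.infinitePi μ).map (fun ω => W n (ω n)) = (μ n).map (W n) := by
    intro W hW n
    have h : AEMeasurable (W n) ((Measure.infinitePi μ).map (Function.eval n)) := by
      rw [(hmp n).map_eq]; exact hW n
    have := AEMeasurable.map_map_of_aemeasurable h (hmp n).aemeasurable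
    rw [(hmp n).map_eq] at this
    exact this.symm
  have hmeas : ∀ {W : ∀ n, Ω n → ℝ}, (∀ n, AEMeasurable (W n) (μ n)) → ∀ n,
      AEMeasurable (fun ω : ∀ n, Ω n => W n (ω n)) (Measure.infinitePi μ) := fun hW n =>
    (hW n).comp_quasiMeasurePreserving (hmp n).quasiMeasurePreserving
  have key := tendstoInDistribution_of_tendstoInMeasure_sub (μ'' := Measure.infinitePi μ)
    (X := fun n ω => X n (ω n)) (l := atTop) (fun n ω => Y n (ω n)) Z (μ' := ν)
    ⟨hmeas hX.forall_aemeasurable, hX.aemeasurable_limit, ?_⟩ ?_ (hmeas hY)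
  · refine ⟨hY, hX.aemeasurable_limit, ?_⟩
    exact key.tendsto.congr fun n => Subtype.ext (hmap hY n)
  · exact hX.tendsto.congr fun n => Subtype.ext (hmap hX.forall_aemeasurable n).symm
  · rw [tendstoInMeasure_iff_norm]
    intro ε hε
    rw [Metric.tendsto_nhds] at hXY
    have h := hXY ε hε
    rw [eventually_probFilter] at h
    refine Tendsto.congr (fun n => ?_) h
    have hns : NullMeasurableSet {z | ¬ dist (Y n z - X n z) 0 < ε} (μ n) := by
      have : AEMeasurable (fun z => dist (Y n z - X n z) 0) (μ n) :=
        ((hY n).sub (hX.forall_aemeasurable n)).dist aemeasurable_const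
      simp only [not_lt]
      exact nullMeasurableSet_le aemeasurable_const this
    rw [← (hmp n).measure_preimage hns]
    congr 1
    ext ω
    simp

/-- The limit law is tight, and the portmanteau inequality for closed sets passes its tail bound on
to the sequence. -/
theorem _root_.MeasureTheory.TendstoInDistribution.bigOP
    (hX : TendstoInDistribution X atTop Z μ ν) : BigOP μ X fun _ => 1 := by
  intro η hη
  have hprob : IsProbabilityMeasure (ν.map Z) := Measure.isProbabilityMeasure_map hX.2
  have htight := isTightMeasureSet_iff_exists_isCompact_measure_compl_le.1
    (isTightMeasureSet_singleton (μ := ν.map Z)) (ENNReal.ofReal (η / 2)) (by simpa using hη)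
  obtain ⟨K, hK, hKle⟩ := htight
  obtain ⟨C, hC⟩ := hK.isBounded.exists_norm_le
  -- The margin `1` makes the closed tail `C + 1 ≤ |x|` disjoint from the compact set `K`.
  refine ⟨C + 1, ?_⟩
  have hclosed : IsClosed {x : ℝ | C + 1 ≤ |x|} := isClosed_le continuous_const continuous_abs
  have hlim := ProbabilityMeasure.limsup_measure_closed_le_of_tendsto hX.tendsto hclosed
  have hlt : limsup (fun n => ((μ n).map (X n)) {x : ℝ | C + 1 ≤ |x|}) atTop
      < ENNReal.ofReal η := by
    refine lt_of_le_of_lt (hlim.trans ((measure_mono ?_).trans (hKle _ rfl))) ?_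
    · intro x hx hxK
      have := hC x hxK
      rw [Real.norm_eq_abs] at this
      simp only [Set.mem_ofPred_eq] at hx
      linarith
    · rw [ENNReal.ofReal_lt_ofReal_iff hη]; linarith
  filter_upwards [eventually_lt_of_limsup_lt hlt] with n hn
  rw [Measure.map_apply_of_aemeasurable (hX.1 n) hclosed.measurableSet] at hn
  refine (measure_mono fun z hz => ?_).trans hn.le
  simp only [mul_one, Set.mem_ofPred_eq, Set.mem_preimage] at hz ⊢
  exact hz.le

omit [∀ n, IsProbabilityMeasure (μ n)] in
theorem BigOP.sub_const (hX : BigOP μ X fun _ => 1) (c : ℝ) :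
    BigOP μ (fun n z => X n z - c) fun _ => 1 := by
  intro η hη
  obtain ⟨C, hC⟩ := hX η hη
  refine ⟨C + |c|, hC.mono fun n hn => (measure_mono fun z hz => ?_).trans hn⟩
  simp only [mul_one, Set.mem_ofPred_eq] at hz ⊢
  have := abs_sub (X n z) c
  linarith

/-- The limit law is defined with mean `√(κ²) = |κ|`, while the statistic produces mean `-κ`; the
symmetry of the centred normal law makes the sign irrelevant after squaring. -/
theorem map_sub_sq_gaussianReal (κ : ℝ) :
    (gaussianReal 0 1).map (fun w => (w - κ) ^ 2) = noncentralChiSqOne (κ ^ 2) := by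
  have h1 : ∀ c : ℝ, (gaussianReal 0 1).map (fun w => (w - c) ^ 2)
      = (gaussianReal (-c) 1).map fun w => w ^ 2 := by
    intro c
    rw [← zero_sub c, ← gaussianReal_map_sub_const, Measure.map_map (by fun_prop) (by fun_prop)]
    rfl
  have h2 : ∀ c : ℝ, (gaussianReal (-c) 1).map (fun w : ℝ => w ^ 2)
      = (gaussianReal c 1).map fun w => w ^ 2 := by
    intro c
    rw [← gaussianReal_map_neg, Measure.map_map (by fun_prop) (by fun_prop)]
    congr 1
    ext w
    simp
  rw [h1, h2, noncentralChiSqOne, Real.sqrt_sq_eq_abs]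
  rcases abs_choice κ with h | h <;> rw [h]
  exact (h2 κ).symm

theorem tendstoInDistribution_noncentralChiSqOne
    (hX : TendstoInDistribution X atTop id μ (gaussianReal 0 1)) (κ : ℝ) :
    TendstoInDistribution (fun n z => (X n z - κ) ^ 2) atTop id μ
      (noncentralChiSqOne (κ ^ 2)) := by
  have h := hX.continuous_comp (g := fun w : ℝ => (w - κ) ^ 2) (by fun_prop)
  refine ⟨h.1, aemeasurable_id, ?_⟩
  convert! h.tendsto using 1
  refine congrArg _ ?_
  refine Subtype.ext ?_
  simp only [Measure.map_id, Function.comp_id]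
  exact (map_sub_sq_gaussianReal κ).symm

end Distribution

/-! ### Coercive matrices and their inverses -/

section QuadraticForm

variable {m : ℕ} {S : Matrix (Fin m) (Fin m) ℝ} {c : ℝ}

theorem mulVec_inv_mulVec_of_coercive (hc : 0 < c)
    (hS : ∀ w, c * (w ⬝ᵥ w) ≤ w ⬝ᵥ (S *ᵥ w)) (w : Fin m → ℝ) : S *ᵥ (S⁻¹ *ᵥ w) = w := by
  have hdet : IsUnit S.det := by
    rw [isUnit_iff_ne_zero]
    intro h
    obtain ⟨w, hw, hw0⟩ := Matrix.exists_mulVec_eq_zero_iff.2 h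
    have h1 := hS w
    rw [hw0, dotProduct_zero] at h1
    have h2 : 0 < w ⬝ᵥ w := by
      simpa using Matrix.dotProduct_star_self_pos_iff.2 hw
    nlinarith
  rw [Matrix.mulVec_mulVec, Matrix.mul_nonsing_inv _ hdet, Matrix.one_mulVec]

theorem dotProduct_self_nonneg' (w : Fin m → ℝ) : 0 ≤ w ⬝ᵥ w :=
  Finset.sum_nonneg fun _ _ => mul_self_nonneg _

/-- For `y = S⁻¹ e_j` the form `y'Sy` equals `y_j`, so coercivity gives `c |y|² ≤ y_j`. This bounds
first `y_j` by `1 / c` and then every `|y_i|` by `1 / c`. No symmetry of `S` is needed. -/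
theorem abs_inv_apply_le_of_coercive (hc : 0 < c)
    (hS : ∀ w, c * (w ⬝ᵥ w) ≤ w ⬝ᵥ (S *ᵥ w)) (i j : Fin m) : |S⁻¹ i j| ≤ 1 / c := by
  set y := S⁻¹ *ᵥ Pi.single j 1 with hy
  have hyi : ∀ i, y i = S⁻¹ i j := fun i => by simp [hy]
  have h1 := hS y
  rw [hy, mulVec_inv_mulVec_of_coercive hc hS, ← hy, dotProduct_single, mul_one] at h1
  have hle : ∀ i, y i ^ 2 ≤ y ⬝ᵥ y := fun i => by
    rw [pow_two]
    exact Finset.single_le_sum (f := fun i => y i * y i) (fun _ _ => mul_self_nonneg _)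
      (Finset.mem_univ i)
  have hj : y j ≤ 1 / c := by
    rw [le_div_iff₀ hc]
    by_contra! h
    have := hle j
    have hpos : 0 < y j := by by_contra! h'; nlinarith
    nlinarith
  rw [← hyi]
  refine abs_le_of_sq_le_sq (a := y i) ?_ (by positivity)
  have h2 : c * y i ^ 2 ≤ 1 / c := (mul_le_mul_of_nonneg_left (hle i) hc.le).trans (h1.trans hj)
  have h3 : y i ^ 2 ≤ 1 / c / c := by rw [le_div_iff₀ hc]; linarith
  calc y i ^ 2 ≤ 1 / c / c := h3
    _ = (1 / c) ^ 2 := by field_simp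

theorem dotProduct_inv_mulVec_comm (hS : S.IsSymm) (a b : Fin m → ℝ) :
    a ⬝ᵥ (S⁻¹ *ᵥ b) = b ⬝ᵥ (S⁻¹ *ᵥ a) := by
  have h : (S⁻¹)ᵀ = S⁻¹ := by rw [Matrix.transpose_nonsing_inv, hS.eq]
  rw [Matrix.dotProduct_mulVec, ← Matrix.mulVec_transpose, h, dotProduct_comm]

/-- Substituting `y = S⁻¹ w` turns forms in `S⁻¹` into forms in `S`, where the eigenvalue bounds are
available. -/
theorem dotProduct_inv_mulVec_eq (hc : 0 < c)
    (hS : ∀ w, c * (w ⬝ᵥ w) ≤ w ⬝ᵥ (S *ᵥ w)) (w : Fin m → ℝ) :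
    w ⬝ᵥ (S⁻¹ *ᵥ w) = (S⁻¹ *ᵥ w) ⬝ᵥ (S *ᵥ (S⁻¹ *ᵥ w)) := by
  rw [mulVec_inv_mulVec_of_coercive hc hS, dotProduct_comm]

theorem dotProduct_inv_mulVec_nonneg (hc : 0 < c)
    (hS : ∀ w, c * (w ⬝ᵥ w) ≤ w ⬝ᵥ (S *ᵥ w)) (w : Fin m → ℝ) : 0 ≤ w ⬝ᵥ (S⁻¹ *ᵥ w) := by
  rw [dotProduct_inv_mulVec_eq hc hS]
  exact (mul_nonneg hc.le (dotProduct_self_nonneg' _)).trans (hS _)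

theorem eq_zero_of_dotProduct_inv_mulVec_eq_zero (hc : 0 < c)
    (hS : ∀ w, c * (w ⬝ᵥ w) ≤ w ⬝ᵥ (S *ᵥ w)) {w : Fin m → ℝ} (h : w ⬝ᵥ (S⁻¹ *ᵥ w) = 0) :
    w = 0 := by
  rw [dotProduct_inv_mulVec_eq hc hS] at h
  have h1 := hS (S⁻¹ *ᵥ w)
  rw [h] at h1
  have h2 : (S⁻¹ *ᵥ w) ⬝ᵥ (S⁻¹ *ᵥ w) = 0 :=
    le_antisymm (by nlinarith) (dotProduct_self_nonneg' _)
  rw [← mulVec_inv_mulVec_of_coercive hc hS w, dotProduct_self_eq_zero.1 h2, Matrix.mulVec_zero]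

theorem measurable_inv_apply {α : Type*} [MeasurableSpace α] {A : α → Matrix (Fin m) (Fin m) ℝ}
    (hA : ∀ i j, Measurable fun x => A x i j) (i j : Fin m) : Measurable fun x => (A x)⁻¹ i j := by
  have hA' : Measurable fun x => (fun i j => A x i j : Fin m → Fin m → ℝ) :=
    measurable_pi_lambda _ fun i => measurable_pi_lambda _ fun j => hA i j
  have hcont : Continuous fun B : Fin m → Fin m → ℝ => (Matrix.of B : Matrix (Fin m) (Fin m) ℝ) :=
    continuous_id
  have hdet : Measurable fun x => (A x).det :=
    (hcont.matrix_det.measurable).comp hA'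
  have hadj : Measurable fun x => (A x).adjugate i j :=
    ((hcont.matrix_adjugate.matrix_elem i j).measurable).comp hA'
  simp only [Matrix.inv_def, Matrix.smul_apply, smul_eq_mul, Ring.inverse_eq_inv']
  exact hdet.inv.mul hadj

end QuadraticForm

/-! ### The weak inner product on `V` -/

namespace Design

variable {𝒳 𝒴 H : Type*} [MeasurableSpace 𝒳] [MeasurableSpace 𝒴] [StandardBorelSpace 𝒴]
  [Nonempty 𝒴] {dθ dρ : ℕ} [NormedAddCommGroup H] [NormedSpace ℝ H]
  {D : Design 𝒳 𝒴 dθ dρ H}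

instance (P : ProbabilityMeasure (𝒳 × 𝒴)) : IsProbabilityMeasure (Model.lawX P) := by
  unfold Model.lawX
  infer_instance

theorem memLp_inv_mulVec_dm (hb : D.BasicConditions) (hl : D.LocalConditions) {v : Param dθ H}
    (hv : v ∈ D.V) (j : Fin dρ) :
    MemLp (fun x => ((D.wt x)⁻¹ *ᵥ D.dm v x) j) 2 (Model.lawX D.P0) := by
  obtain ⟨c, C, hc, hwt⟩ := hb.wt_bounds
  simp only [Matrix.mulVec, dotProduct]
  refine memLp_finsetSum _ fun i _ => ?_
  have hm := measurable_inv_apply hb.measurable_wt j i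
  refine MemLp.of_le_mul (c := 1 / c) (hl.memLp_dm v hv i)
    (hm.aestronglyMeasurable.mul (hl.memLp_dm v hv i).1) (ae_of_all _ fun x => ?_)
  rw [norm_mul]
  exact mul_le_mul_of_nonneg_right
    (abs_inv_apply_le_of_coercive hc (fun w => (hwt x w).1) j i) (norm_nonneg _)

theorem integrable_dm_dotProduct (hb : D.BasicConditions) (hl : D.LocalConditions)
    {v w : Param dθ H} (hv : v ∈ D.V) (hw : w ∈ D.V) :
    Integrable (fun x => D.dm v x ⬝ᵥ ((D.wt x)⁻¹ *ᵥ D.dm w x)) (Model.lawX D.P0) := by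
  simp only [dotProduct]
  exact integrable_finsetSum _ fun j _ =>
    (hl.memLp_dm v hv j).integrable_mul (memLp_inv_mulVec_dm hb hl hw j)

theorem weakInner_comm (hb : D.BasicConditions) (v w : Param dθ H) :
    D.weakInner v w = D.weakInner w v :=
  integral_congr_ae (ae_of_all _ fun x => dotProduct_inv_mulVec_comm (hb.wt_symm x) _ _)

theorem weakInner_self_nonneg (hb : D.BasicConditions) (v : Param dθ H) :
    0 ≤ D.weakInner v v := by
  obtain ⟨c, C, hc, hwt⟩ := hb.wt_bounds
  exact integral_nonneg fun x => dotProduct_inv_mulVec_nonneg hc (fun w => (hwt x w).1) _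

theorem weakInner_linear_left (hb : D.BasicConditions) (hl : D.LocalConditions)
    {v w u : Param dθ H} (hv : v ∈ D.V) (hw : w ∈ D.V) (hu : u ∈ D.V) (a b : ℝ) :
    D.weakInner (a • v + b • w) u = a * D.weakInner v u + b * D.weakInner w u := by
  unfold Model.weakInner
  rw [← integral_const_mul, ← integral_const_mul, ← integral_add
    ((integrable_dm_dotProduct hb hl hv hu).const_mul a)
    ((integrable_dm_dotProduct hb hl hw hu).const_mul b)]
  refine integral_congr_ae ?_
  filter_upwards [hl.linear v hv w hw a b] with x hx
  simp [hx, add_dotProduct, smul_dotProduct]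

/-- The inner product `⟨v, w⟩` as a bilinear form on `V`. -/
noncomputable def weakForm (hb : D.BasicConditions) (hl : D.LocalConditions) :
    LinearMap.BilinForm ℝ D.V :=
  have hadd : ∀ u v w : D.V, D.weakInner (u + v : D.V) w = D.weakInner u w + D.weakInner v w :=
    fun u v w => by simpa using weakInner_linear_left hb hl u.2 v.2 w.2 1 1
  have hsmul : ∀ (a : ℝ) (u w : D.V), D.weakInner (a • u : D.V) w = a * D.weakInner u w :=
    fun a u w => by simpa using weakInner_linear_left hb hl u.2 u.2 w.2 a 0
  LinearMap.mk₂ ℝ (fun v w : D.V => D.weakInner v w) hadd hsmul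
    (fun u v w => by
      rw [weakInner_comm hb u, hadd, weakInner_comm hb v, weakInner_comm hb w])
    (fun a u w => by rw [weakInner_comm hb u, hsmul, weakInner_comm hb w]; rfl)

/-- Cauchy–Schwarz for a positive semidefinite form; definiteness is available only on the sieve
tangent spaces. -/
theorem weakInner_sq_le (hb : D.BasicConditions) (hl : D.LocalConditions) {v w : Param dθ H}
    (hv : v ∈ D.V) (hw : w ∈ D.V) :
    D.weakInner v w ^ 2 ≤ D.weakInner v v * D.weakInner w w :=
  (weakForm hb hl).apply_sq_le_of_symm (fun x => weakInner_self_nonneg hb x)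
    ⟨fun x y => weakInner_comm hb x y⟩ ⟨v, hv⟩ ⟨w, hw⟩

theorem weakInner_add_left (hb : D.BasicConditions) (hl : D.LocalConditions)
    {v w u : Param dθ H} (hv : v ∈ D.V) (hw : w ∈ D.V) (hu : u ∈ D.V) :
    D.weakInner (v + w) u = D.weakInner v u + D.weakInner w u := by
  simpa using weakInner_linear_left hb hl hv hw hu 1 1

theorem weakInner_smul_left (hb : D.BasicConditions) (hl : D.LocalConditions)
    {v u : Param dθ H} (hv : v ∈ D.V) (hu : u ∈ D.V) (a : ℝ) :
    D.weakInner (a • v) u = a * D.weakInner v u := by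
  simpa using weakInner_linear_left hb hl hv hv hu a 0

theorem weakInner_add_right (hb : D.BasicConditions) (hl : D.LocalConditions)
    {v w u : Param dθ H} (hv : v ∈ D.V) (hw : w ∈ D.V) (hu : u ∈ D.V) :
    D.weakInner u (v + w) = D.weakInner u v + D.weakInner u w := by
  rw [weakInner_comm hb, weakInner_add_left hb hl hv hw hu, weakInner_comm hb v,
    weakInner_comm hb w]

theorem weakInner_smul_right (hb : D.BasicConditions) (hl : D.LocalConditions)
    {v u : Param dθ H} (hv : v ∈ D.V) (hu : u ∈ D.V) (a : ℝ) :
    D.weakInner u (a • v) = a * D.weakInner u v := by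
  rw [weakInner_comm hb, weakInner_smul_left hb hl hv hu, weakInner_comm hb v]

theorem weakInner_sub_right (hb : D.BasicConditions) (hl : D.LocalConditions)
    {v w u : Param dθ H} (hv : v ∈ D.V) (hw : w ∈ D.V) (hu : u ∈ D.V) :
    D.weakInner u (v - w) = D.weakInner u v - D.weakInner u w := by
  rw [sub_eq_add_neg, ← neg_one_smul ℝ w,
    weakInner_add_right hb hl hv (D.V.smul_mem _ hw) hu, weakInner_smul_right hb hl hw hu]
  ring

theorem weakNorm_nonneg (v : Param dθ H) : 0 ≤ D.weakNorm v :=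
  Real.sqrt_nonneg _

theorem weakNorm_sq (hb : D.BasicConditions) (v : Param dθ H) :
    D.weakNorm v ^ 2 = D.weakInner v v :=
  Real.sq_sqrt (weakInner_self_nonneg hb v)

theorem abs_weakInner_le (hb : D.BasicConditions) (hl : D.LocalConditions) {v w : Param dθ H}
    (hv : v ∈ D.V) (hw : w ∈ D.V) : |D.weakInner v w| ≤ D.weakNorm v * D.weakNorm w := by
  refine abs_le_of_sq_le_sq ?_ (mul_nonneg (weakNorm_nonneg _) (weakNorm_nonneg _))
  rw [mul_pow, weakNorm_sq hb, weakNorm_sq hb]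
  exact weakInner_sq_le hb hl hv hw

theorem weakNorm_add_le (hb : D.BasicConditions) (hl : D.LocalConditions) {v w : Param dθ H}
    (hv : v ∈ D.V) (hw : w ∈ D.V) : D.weakNorm (v + w) ≤ D.weakNorm v + D.weakNorm w := by
  refine le_of_abs_le (abs_le_of_sq_le_sq ?_ (add_nonneg (weakNorm_nonneg _) (weakNorm_nonneg _)))
  have h := le_of_abs_le (abs_weakInner_le hb hl hv hw)
  rw [weakNorm_sq hb, weakInner_add_left hb hl hv hw (D.V.add_mem hv hw),
    weakInner_add_right hb hl hv hw hv, weakInner_add_right hb hl hv hw hw,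
    weakInner_comm hb w v, ← weakNorm_sq hb, ← weakNorm_sq hb]
  linarith

theorem weakNorm_smul (hb : D.BasicConditions) (hl : D.LocalConditions) {v : Param dθ H}
    (hv : v ∈ D.V) (a : ℝ) : D.weakNorm (a • v) = |a| * D.weakNorm v := by
  rw [Model.weakNorm, weakInner_smul_left hb hl hv (D.V.smul_mem a hv),
    weakInner_smul_right hb hl hv hv, ← mul_assoc, Real.sqrt_mul (mul_self_nonneg a),
    Real.sqrt_mul_self_eq_abs, Model.weakNorm]

theorem weakNorm_sub_comm (hb : D.BasicConditions) (hl : D.LocalConditions) {v w : Param dθ H}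
    (h : v - w ∈ D.V) : D.weakNorm (w - v) = D.weakNorm (v - w) := by
  have := weakNorm_smul hb hl h (-1)
  simpa using this

theorem alpha0_mem_A (hb : D.BasicConditions) : D.alpha0 ∈ D.A :=
  (interior_subset hb.theta0_mem : D.alpha0.1 ∈ D.Theta)

/-! ### Identification and the variance of the score -/

theorem condMean_alpha0 (hb : D.BasicConditions) :
    ∀ᵐ x ∂(Model.lawX D.P0), D.condMean D.P0 D.alpha0 x = 0 :=
  (hb.identified.identified _ (alpha0_mem_A hb)).2 rfl

/-- A nonnegative integrable function with zero integral vanishes almost surely, and a positive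
definite form vanishes only at zero, so the conditional mean is zero and identification applies.
Integrability matters, as a non-integrable function also has integral `0` by convention. -/
theorem eq_alpha0_of_Q_eq_zero (hb : D.BasicConditions) {α : Param dθ H} (hα : α ∈ D.A)
    (h : D.Q D.P0 α = 0) : α = D.alpha0 := by
  obtain ⟨c, C, hc, hwt⟩ := hb.wt_bounds
  refine (hb.identified.identified α hα).1 ?_
  rw [Model.Q, integral_eq_zero_iff_of_nonneg (f := D.critIntegrand D.P0 α)
    (fun x => dotProduct_inv_mulVec_nonneg hc (fun w => (hwt x w).1) _)
    (hb.identified.integrable_crit α hα)] at h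
  filter_upwards [h] with x hx
  exact eq_zero_of_dotProduct_inv_mulVec_eq_zero hc (fun w => (hwt x w).1) hx

theorem Q_nonneg (hb : D.BasicConditions) (P : ProbabilityMeasure (𝒳 × 𝒴)) (α : Param dθ H) :
    0 ≤ D.Q P α := by
  obtain ⟨c, C, hc, hwt⟩ := hb.wt_bounds
  exact integral_nonneg fun x => dotProduct_inv_mulVec_nonneg hc (fun w => (hwt x w).1) _

theorem Q_pos (hb : D.BasicConditions) {α : Param dθ H} (hα : α ∈ D.A) (h : α ≠ D.alpha0) :
    0 < D.Q D.P0 α :=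
  (Q_nonneg hb _ α).lt_of_ne fun h0 => h (eq_alpha0_of_Q_eq_zero hb hα h0.symm)

/-- The law of total expectation for the square of `y(X)'ρ(Z; α₀)`. -/
theorem integral_sq_dotProduct_rho (hb : D.BasicConditions) {y : 𝒳 → Fin dρ → ℝ}
    (hy : ∀ j, MemLp (fun x => y x j) 2 (Model.lawX D.P0)) :
    MemLp (fun z => y z.1 ⬝ᵥ D.rho z D.alpha0) 2 (D.P0 : Measure (𝒳 × 𝒴)) ∧
    ∫ z, (y z.1 ⬝ᵥ D.rho z D.alpha0) ^ 2 ∂(D.P0 : Measure (𝒳 × 𝒴))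
      = ∫ x, y x ⬝ᵥ (D.Sigma0 x *ᵥ y x) ∂(Model.lawX D.P0) ∧
    Integrable (fun x => y x ⬝ᵥ (D.Sigma0 x *ᵥ y x)) (Model.lawX D.P0) := by
  obtain ⟨c, C, hc, hS⟩ := hb.Sigma0_bounds
  have hy' : ∀ j, AEStronglyMeasurable (fun z : 𝒳 × 𝒴 => y z.1 j) (D.P0 : Measure (𝒳 × 𝒴)) :=
    fun j => (hy j).1.comp_quasiMeasurePreserving (MeasurePreserving.quasiMeasurePreserving
      (⟨measurable_fst, rfl⟩ : MeasurePreserving Prod.fst (D.P0 : Measure (𝒳 × 𝒴))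
        (Model.lawX D.P0)))
  have hmeas : AEStronglyMeasurable (fun z => y z.1 ⬝ᵥ D.rho z D.alpha0)
      (D.P0 : Measure (𝒳 × 𝒴)) := by
    simp only [dotProduct]
    exact Finset.aestronglyMeasurable_fun_sum _ fun j _ => (hy' j).mul (hb.memLp_rho j).1
  have hmeas2 : AEStronglyMeasurable (fun z => (y z.1 ⬝ᵥ D.rho z D.alpha0) ^ 2)
      (D.P0 : Measure (𝒳 × 𝒴)) := hmeas.pow 2
  have hrho : ∀ i j, ∀ᵐ x ∂(Model.lawX D.P0),
      Integrable (fun ω => D.rho (x, ω) D.alpha0 i * D.rho (x, ω) D.alpha0 j)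
        ((D.P0 : Measure (𝒳 × 𝒴)).condKernel x) := fun i j =>
    ((hb.memLp_rho i).integrable_mul (hb.memLp_rho j)).condKernel_ae
  have hexp : ∀ x ω, (y x ⬝ᵥ D.rho (x, ω) D.alpha0) ^ 2 =
      ∑ i, ∑ j, y x i * (y x j * (D.rho (x, ω) D.alpha0 i * D.rho (x, ω) D.alpha0 j)) := by
    intro x ω
    rw [pow_two, dotProduct, Finset.sum_mul_sum]
    exact Finset.sum_congr rfl fun i _ => Finset.sum_congr rfl fun j _ => by ring
  have hint : ∀ᵐ x ∂(Model.lawX D.P0),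
      Integrable (fun ω => (y x ⬝ᵥ D.rho (x, ω) D.alpha0) ^ 2)
        ((D.P0 : Measure (𝒳 × 𝒴)).condKernel x) := by
    filter_upwards [ae_all_iff.2 fun i => ae_all_iff.2 (hrho i)] with x hx
    simp only [hexp]
    exact integrable_finsetSum _ fun i _ => integrable_finsetSum _ fun j _ =>
      ((hx i j).const_mul _).const_mul _
  have hcond : ∀ᵐ x ∂(Model.lawX D.P0),
      ∫ ω, (y x ⬝ᵥ D.rho (x, ω) D.alpha0) ^ 2 ∂((D.P0 : Measure (𝒳 × 𝒴)).condKernel x)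
        = y x ⬝ᵥ (D.Sigma0 x *ᵥ y x) := by
    filter_upwards [ae_all_iff.2 fun i => ae_all_iff.2 (hrho i), condMean_alpha0 hb]
      with x hx hx0
    simp only [hexp]
    rw [integral_finsetSum _ fun i _ => integrable_finsetSum _ fun j _ =>
      ((hx i j).const_mul _).const_mul _]
    simp only [dotProduct, Matrix.mulVec]
    refine Finset.sum_congr rfl fun i _ => ?_
    rw [integral_finsetSum _ fun j _ => ((hx i j).const_mul _).const_mul _, Finset.mul_sum]
    refine Finset.sum_congr rfl fun j _ => ?_
    rw [integral_const_mul, integral_const_mul, Model.Sigma0]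
    simp only [hx0, Pi.zero_apply, sub_zero]
    ring
  have hyy : Integrable (fun x => y x ⬝ᵥ y x) (Model.lawX D.P0) := by
    simp only [dotProduct]
    exact integrable_finsetSum _ fun j _ => (hy j).integrable_mul (hy j)
  have hSint : Integrable (fun x => y x ⬝ᵥ (D.Sigma0 x *ᵥ y x)) (Model.lawX D.P0) := by
    refine Integrable.mono' (hyy.const_mul C) ?_ ?_
    -- Measurability of the form in `Sigma0` is inherited from the conditional integral with which
    -- it agrees almost everywhere.
    · exact hmeas2.integral_condKernel.congr hcond
    · filter_upwards [hS] with x hx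
      rw [Real.norm_of_nonneg
        ((mul_nonneg hc.le (dotProduct_self_nonneg' _)).trans (hx (y x)).1)]
      exact (hx (y x)).2
  -- A product of two square integrable factors need not be square integrable. Here the conditional
  -- second moment is at most `C |y(x)|²`, which is integrable, and disintegration gives
  -- integrability of the square.
  have hsq : Integrable (fun z => (y z.1 ⬝ᵥ D.rho z D.alpha0) ^ 2)
      (D.P0 : Measure (𝒳 × 𝒴)) := by
    rw [← hmeas2.ae_integrable_condKernel_iff]
    refine ⟨hint, ?_⟩
    simp only [norm_pow, Real.norm_eq_abs, sq_abs]
    exact hSint.congr (hcond.mono fun x hx => hx.symm)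
  refine ⟨(memLp_two_iff_integrable_sq hmeas).2 hsq, ?_, hSint⟩
  rw [← Measure.integral_condKernel hsq]
  exact integral_congr_ae hcond

theorem integral_dotProduct_rho (hb : D.BasicConditions) {y : 𝒳 → Fin dρ → ℝ}
    (hy : ∀ j, MemLp (fun x => y x j) 2 (Model.lawX D.P0)) :
    ∫ z, y z.1 ⬝ᵥ D.rho z D.alpha0 ∂(D.P0 : Measure (𝒳 × 𝒴)) = 0 := by
  rw [← Measure.integral_condKernel
    ((integral_sq_dotProduct_rho hb hy).1.integrable (by norm_num))]
  have hrho : ∀ j, ∀ᵐ x ∂(Model.lawX D.P0), Integrable (fun ω => D.rho (x, ω) D.alpha0 j)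
      ((D.P0 : Measure (𝒳 × 𝒴)).condKernel x) := fun j =>
    ((hb.memLp_rho j).integrable (by norm_num)).condKernel_ae
  rw [← integral_zero 𝒳 ℝ (μ := (D.P0 : Measure (𝒳 × 𝒴)).fst)]
  refine integral_congr_ae ?_
  filter_upwards [ae_all_iff.2 hrho, condMean_alpha0 hb] with x hx hx0
  simp only [dotProduct]
  rw [integral_finsetSum _ fun j _ => (hx j).const_mul _]
  refine Finset.sum_eq_zero fun j _ => ?_
  rw [integral_const_mul]
  have : ∫ ω, D.rho (x, ω) D.alpha0 j ∂((D.P0 : Measure (𝒳 × 𝒴)).condKernel x) = 0 :=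
    congrFun hx0 j
  rw [this, mul_zero]

/-- The norms `‖·‖` and `‖·‖_sd` are equivalent on `V`. -/
theorem exists_sdNorm_bounds (hb : D.BasicConditions) (hl : D.LocalConditions) :
    ∃ c C : ℝ, 0 < c ∧ 0 < C ∧ ∀ v ∈ D.V,
      c * D.weakNorm v ^ 2 ≤ D.sdNorm v ^ 2 ∧ D.sdNorm v ^ 2 ≤ C * D.weakNorm v ^ 2 := by
  obtain ⟨c, C, hc, hwt⟩ := hb.wt_bounds
  obtain ⟨c', C', hc', hS⟩ := hb.Sigma0_bounds
  have hC : 0 < max C 1 := by positivity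
  have hC' : 0 < max C' 1 := by positivity
  refine ⟨c' / max C 1, max C' 1 / c, by positivity, by positivity, fun v hv => ?_⟩
  -- In terms of `y = Σ⁻¹ dm[v]` the two squared norms are `E[y'Σy]` and `E[y'Σ₀y]`, both comparable
  -- to `E|y|²`. The maxima with `1` only keep the upper constants positive.
  set y : 𝒳 → Fin dρ → ℝ := fun x => (D.wt x)⁻¹ *ᵥ D.dm v x with hy
  have hyL : ∀ j, MemLp (fun x => y x j) 2 (Model.lawX D.P0) := memLp_inv_mulVec_dm hb hl hv
  obtain ⟨hL2, hint, hSint⟩ := integral_sq_dotProduct_rho hb hyL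
  have hyy : Integrable (fun x => y x ⬝ᵥ y x) (Model.lawX D.P0) := by
    simp only [dotProduct]
    exact integrable_finsetSum _ fun j _ => (hyL j).integrable_mul (hyL j)
  have hscore : D.score v D.alpha0 = fun z => y z.1 ⬝ᵥ D.rho z D.alpha0 := by
    ext z
    rw [Model.score, dotProduct_inv_mulVec_comm (hb.wt_symm _), dotProduct_comm]
  have hsd : D.sdNorm v ^ 2 = ∫ x, y x ⬝ᵥ (D.Sigma0 x *ᵥ y x) ∂(Model.lawX D.P0) := by
    rw [Model.sdNorm, Real.sq_sqrt (variance_nonneg _ _), hscore, variance_eq_sub hL2,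
      integral_dotProduct_rho hb hyL, ← hint]
    simp
  have hweak : D.weakNorm v ^ 2 = ∫ x, y x ⬝ᵥ (D.wt x *ᵥ y x) ∂(Model.lawX D.P0) := by
    rw [weakNorm_sq hb]
    exact integral_congr_ae (ae_of_all _ fun x =>
      dotProduct_inv_mulVec_eq hc (fun w => (hwt x w).1) _)
  have hwint : Integrable (fun x => y x ⬝ᵥ (D.wt x *ᵥ y x)) (Model.lawX D.P0) :=
    (integrable_dm_dotProduct hb hl hv hv).congr (ae_of_all _ fun x =>
      dotProduct_inv_mulVec_eq hc (fun w => (hwt x w).1) _)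
  have h1 : c * ∫ x, y x ⬝ᵥ y x ∂(Model.lawX D.P0) ≤ D.weakNorm v ^ 2 := by
    rw [hweak, ← integral_const_mul]
    exact integral_mono (hyy.const_mul c) hwint fun x => (hwt x _).1
  have h2 : D.weakNorm v ^ 2 ≤ max C 1 * ∫ x, y x ⬝ᵥ y x ∂(Model.lawX D.P0) := by
    rw [hweak, ← integral_const_mul]
    exact integral_mono hwint (hyy.const_mul _) fun x => (hwt x _).2.trans
      (mul_le_mul_of_nonneg_right (le_max_left _ _) (dotProduct_self_nonneg' _))
  have h3 : c' * ∫ x, y x ⬝ᵥ y x ∂(Model.lawX D.P0) ≤ D.sdNorm v ^ 2 := by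
    rw [hsd, ← integral_const_mul]
    exact integral_mono_ae (hyy.const_mul c') hSint (hS.mono fun x hx => (hx _).1)
  have h4 : D.sdNorm v ^ 2 ≤ max C' 1 * ∫ x, y x ⬝ᵥ y x ∂(Model.lawX D.P0) := by
    rw [hsd, ← integral_const_mul]
    exact integral_mono_ae hSint (hyy.const_mul _) (hS.mono fun x hx => (hx _).2.trans
      (mul_le_mul_of_nonneg_right (le_max_left _ _) (dotProduct_self_nonneg' _)))
  constructor
  · rw [div_mul_eq_mul_div, div_le_iff₀ hC]
    nlinarith
  · rw [div_mul_eq_mul_div, le_div_iff₀ hc]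
    nlinarith

theorem sdNorm_nonneg (v : Param dθ H) : 0 ≤ D.sdNorm v :=
  Real.sqrt_nonneg _

end Design

/-! ### The strong norm, and comparison of norms in finite dimension -/

section StrongNorm

variable {H : Type*} [NormedAddCommGroup H] {dθ : ℕ}

theorem strongNorm_nonneg (v : Param dθ H) : 0 ≤ strongNorm v :=
  add_nonneg (norm_nonneg _) (norm_nonneg _)

theorem strongNorm_add_le (v w : Param dθ H) :
    strongNorm (v + w) ≤ strongNorm v + strongNorm w := by
  have h1 := norm_add_le v.1 w.1
  have h2 := norm_add_le v.2 w.2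
  simp only [strongNorm, Prod.fst_add, Prod.snd_add]
  linarith

theorem strongNorm_le_two_mul_norm (v : Param dθ H) : strongNorm v ≤ 2 * ‖v‖ := by
  have h1 := norm_fst_le v
  have h2 := norm_snd_le v
  rw [strongNorm]
  linarith

theorem continuous_strongNorm : Continuous (strongNorm : Param dθ H → ℝ) := by
  unfold strongNorm
  fun_prop

end StrongNorm

/-- On a finite dimensional space, a positive definite bilinear form bounds the norm. -/
theorem exists_norm_le_mul_sqrt_form {E : Type*} [NormedAddCommGroup E] [NormedSpace ℝ E]
    [FiniteDimensional ℝ E] (b : LinearMap.BilinForm ℝ E) (hb : ∀ x, x ≠ 0 → 0 < b x x) :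
    ∃ K : ℝ, 0 ≤ K ∧ ∀ x, ‖x‖ ≤ K * Real.sqrt (b x x) := by
  have hcont : Continuous fun x => b x x := by
    let e := Module.finBasis ℝ E
    have h : ∀ x, b x x = ∑ i, e.repr x i * b (e i) x := fun x =>
      calc b x x = b (∑ i, e.repr x i • e i) x := by rw [e.sum_repr]
        _ = _ := by simp only [map_sum, LinearMap.sum_apply, map_smul, LinearMap.smul_apply,
            smul_eq_mul]
    simp only [h]
    refine continuous_finsetSum _ fun i _ => Continuous.mul ?_ ?_
    · exact (e.coord i).continuous_of_finiteDimensional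
    · exact (b (e i)).continuous_of_finiteDimensional
  rcases (Metric.sphere (0 : E) 1).eq_empty_or_nonempty with h | h
  · refine ⟨0, le_rfl, fun x => ?_⟩
    have : x = 0 := by
      by_contra hx
      have : ‖x‖⁻¹ • x ∈ Metric.sphere (0 : E) 1 := by
        simp [norm_smul, hx]
      rw [h] at this
      exact this
    simp [this]
  · obtain ⟨x₀, hx₀, hmin⟩ := (isCompact_sphere (0 : E) 1).exists_isMinOn h hcont.continuousOn
    have hx₀' : x₀ ≠ 0 := by
      rintro rfl
      simp at hx₀
    have hpos := hb x₀ hx₀'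
    have hs : 0 < Real.sqrt (b x₀ x₀) := Real.sqrt_pos.2 hpos
    refine ⟨(Real.sqrt (b x₀ x₀))⁻¹, by positivity, fun x => ?_⟩
    by_cases hx : x = 0
    · simp [hx]
    have hn : 0 < ‖x‖ := norm_pos_iff.2 hx
    have hmem : ‖x‖⁻¹ • x ∈ Metric.sphere (0 : E) 1 := by simp [norm_smul, hx]
    have h1 : b x₀ x₀ ≤ b (‖x‖⁻¹ • x) (‖x‖⁻¹ • x) := hmin hmem
    simp only [map_smul, LinearMap.smul_apply, smul_eq_mul] at h1
    rw [← mul_assoc, ← mul_inv, inv_mul_eq_div, le_div_iff₀ (by positivity)] at h1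
    have h2 := Real.sqrt_le_sqrt h1
    rw [Real.sqrt_mul hpos.le, Real.sqrt_mul_self hn.le] at h2
    rw [inv_mul_eq_div, le_div_iff₀ hs]
    linarith

/-! ### Sieve tangent spaces, ill-posedness and rates -/

namespace Design

variable {𝒳 𝒴 H : Type*} [MeasurableSpace 𝒳] [MeasurableSpace 𝒴] [StandardBorelSpace 𝒴]
  [Nonempty 𝒴] {dθ dρ : ℕ} [NormedAddCommGroup H] [NormedSpace ℝ H]
  {D : Design 𝒳 𝒴 dθ dρ H}

omit [StandardBorelSpace 𝒴] [Nonempty 𝒴] in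
theorem Ak_subset_Vn {n : ℕ} {α : Param dθ H} (h : α ∈ D.Ak n) : α ∈ D.Vn n :=
  Submodule.mem_prod.2 ⟨Submodule.mem_top, h.2⟩

theorem projA_mem_Vn (hb : D.BasicConditions) (n : ℕ) (α : Param dθ H) :
    D.projA n α ∈ D.Vn n :=
  Submodule.mem_prod.2 ⟨Submodule.mem_top, hb.proj_mem n _⟩

theorem tendsto_strongNorm_projA (hb : D.BasicConditions) :
    Tendsto (fun n => strongNorm (D.projA n D.alpha0 - D.alpha0)) atTop (𝓝 0) := by
  simpa [strongNorm, projA] using hb.proj_tendsto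

theorem eventually_projA_mem_Aos (hb : D.BasicConditions) (hr : D.RateConditions)
    (hl : D.LocalConditions) : ∀ᶠ n in atTop, D.projA n D.alpha0 ∈ D.Aos := by
  obtain ⟨r, hr0, hAos⟩ := hl.Aos_nhd
  filter_upwards [(tendsto_strongNorm_projA hb).eventually_lt_const hr0, hr.Pen_proj]
    with n h1 h2
  exact hAos _ (interior_subset hb.theta0_mem : D.alpha0.1 ∈ D.Theta) h1 h2

omit [StandardBorelSpace 𝒴] [Nonempty 𝒴] in
theorem sub_alpha0_mem_V {α : Param dθ H} (h : α ∈ D.Aos) : α - D.alpha0 ∈ D.V :=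
  Submodule.subset_span ⟨α, h, rfl⟩

/-- `V` is the span of differences `α - α₀`, so this is not immediate. For large `n` both `Π_n α₀`
and `Π_n α₀ - α₀` lie in `V`. Afterwards `α₀`, the sieve spaces and their differences can all be
used in the inner product. -/
theorem alpha0_mem_V (hb : D.BasicConditions) (hr : D.RateConditions)
    (hl : D.LocalConditions) : D.alpha0 ∈ D.V := by
  obtain ⟨n, hn⟩ := (eventually_projA_mem_Aos hb hr hl).exists
  have := D.V.sub_mem (hl.Vn_le n (projA_mem_Vn hb n D.alpha0)) (sub_alpha0_mem_V hn)
  simpa using this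

/-- The weak projection error is orthogonal to the sieve tangent space. -/
theorem weakInner_projection_eq_zero (hb : D.BasicConditions) (hr : D.RateConditions)
    (hl : D.LocalConditions) {a : ℕ → Param dθ H} (ha : D.IsWeakProjection a) {n : ℕ}
    {w : Param dθ H} (hw : w ∈ D.Vn n) : D.weakInner w (a n - D.alpha0) = 0 := by
  have hwV := hl.Vn_le n hw
  have hdV : a n - D.alpha0 ∈ D.V :=
    D.V.sub_mem (hl.Vn_le n (ha n).1) (alpha0_mem_V hb hr hl)
  have key : ∀ t : ℝ, 0 ≤ 2 * t * D.weakInner w (a n - D.alpha0) + t ^ 2 * D.weakInner w w := by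
    intro t
    have h1 := (ha n).2 (a n + t • w) ((D.Vn n).add_mem (ha n).1 ((D.Vn n).smul_mem t hw))
    have h2 : a n + t • w - D.alpha0 = (a n - D.alpha0) + t • w := by abel
    have h3 : D.weakNorm (a n - D.alpha0) ^ 2 ≤ D.weakNorm ((a n - D.alpha0) + t • w) ^ 2 := by
      rw [← h2]
      exact pow_le_pow_left₀ (weakNorm_nonneg _) h1 2
    have htw := D.V.smul_mem t hwV
    rw [weakNorm_sq hb, weakNorm_sq hb, weakInner_add_left hb hl hdV htw (D.V.add_mem hdV htw),
      weakInner_add_right hb hl hdV htw hdV, weakInner_add_right hb hl hdV htw htw,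
      weakInner_smul_left hb hl hwV hdV, weakInner_smul_left hb hl hwV htw,
      weakInner_smul_right hb hl hwV hdV, weakInner_smul_right hb hl hwV hwV,
      weakInner_comm hb (a n - D.alpha0) w] at h3
    linarith
  have hq := weakInner_self_nonneg hb w
  by_contra hne
  -- Nearly the minimizing `t` of the quadratic; the `+ 1` avoids dividing by zero and still makes
  -- the value negative when the inner product is nonzero.
  have h := key (-(D.weakInner w (a n - D.alpha0)) / (D.weakInner w w + 1))
  have hpos : 0 < D.weakInner w w + 1 := by linarith
  have hsq : 0 < D.weakInner w (a n - D.alpha0) ^ 2 := by positivity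
  field_simp at h
  nlinarith

/-- The weak norm is definite on the finite dimensional tangent space, hence dominates any norm
there. The constant may depend on `n`; it serves only to make the supremum in `tau` finite. -/
theorem exists_strongNorm_le_weakNorm (hb : D.BasicConditions) (hl : D.LocalConditions)
    (n : ℕ) : ∃ K : ℝ, ∀ v ∈ D.Vn n, strongNorm v ≤ K * D.weakNorm v := by
  have hfin : FiniteDimensional ℝ (D.Vn n) := by
    have := hb.sieve_finite (D.k n)
    rw [FiniteDimensional, Module.Finite.iff_fg]
    exact (Module.Finite.fg_top).prod (Module.Finite.iff_fg.1 this)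
  let ι := Submodule.inclusion (hl.Vn_le n)
  obtain ⟨K, hK0, hK⟩ := exists_norm_le_mul_sqrt_form (E := D.Vn n)
    ((weakForm hb hl).compl₁₂ ι ι) fun x hx => by
      have h := hl.weakNorm_ne n x x.2 (by simpa using hx)
      have : 0 < D.weakNorm (x : Param dθ H) := (weakNorm_nonneg _).lt_of_ne h.symm
      exact Real.sqrt_pos.1 this
  refine ⟨2 * K, fun v hv => (strongNorm_le_two_mul_norm v).trans ?_⟩
  rw [mul_assoc]
  exact mul_le_mul_of_nonneg_left (hK ⟨v, hv⟩) (by norm_num)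

theorem tau_nonneg (n : ℕ) : 0 ≤ D.tau n := by
  refine Real.sSup_nonneg ?_
  rintro _ ⟨α, -, -, rfl⟩
  exact div_nonneg (strongNorm_nonneg _) (weakNorm_nonneg _)

/-- A real `sSup` is an upper bound only for a set bounded above, which the finite dimensional
comparison supplies. The same comparison settles the case excluded from the supremum, where the weak
norm vanishes. -/
theorem strongNorm_le_tau_mul (hb : D.BasicConditions) (hl : D.LocalConditions) {n : ℕ}
    {α : Param dθ H} (hα : α ∈ D.Aosn n) :
    strongNorm (α - D.projA n D.alpha0) ≤ D.tau n * D.weakNorm (α - D.projA n D.alpha0) := by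
  obtain ⟨K, hK⟩ := exists_strongNorm_le_weakNorm hb hl n
  have hV : ∀ β ∈ D.Aosn n, β - D.projA n D.alpha0 ∈ D.Vn n := fun β hβ =>
    (D.Vn n).sub_mem (Ak_subset_Vn hβ.2) (projA_mem_Vn hb n _)
  by_cases h0 : D.weakNorm (α - D.projA n D.alpha0) = 0
  · have := hK _ (hV α hα)
    rw [h0, mul_zero] at this ⊢
    exact this
  have hpos : 0 < D.weakNorm (α - D.projA n D.alpha0) := (weakNorm_nonneg _).lt_of_ne' h0
  rw [← div_le_iff₀ hpos]
  refine le_csSup ⟨K, ?_⟩ ⟨α, hα, h0, rfl⟩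
  rintro _ ⟨β, hβ, hβ0, rfl⟩
  rw [div_le_iff₀ ((weakNorm_nonneg _).lt_of_ne' hβ0)]
  exact hK _ (hV β hβ)

theorem tendsto_Mn (hr : D.RateConditions) : Tendsto D.Mn atTop atTop := by
  have h1 : Tendsto (fun n : ℕ => Real.log (Real.log ((n : ℝ) + 1))) atTop atTop :=
    Real.tendsto_log_atTop.comp (Real.tendsto_log_atTop.comp
      (tendsto_atTop_add_const_right _ _ tendsto_natCast_atTop_atTop))
  have h2 : Tendsto (fun n => Real.log ((D.delS n)⁻¹ + 1)) atTop atTop := by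
    refine Real.tendsto_log_atTop.comp (tendsto_atTop_add_const_right _ _ ?_)
    refine tendsto_inv_nhdsGT_zero.comp (tendsto_nhdsWithin_iff.2 ⟨hr.delS_tendsto, ?_⟩)
    exact hr.delS_pos
  rw [tendsto_atTop] at h1 h2 ⊢
  exact fun b => (h1 b).mp ((h2 b).mono fun n hn hn' => le_min hn' hn)

/-- The radius of `T_n` is of larger order than `n^{-1/2}`. -/
theorem tendsto_radius (hr : D.RateConditions) :
    Tendsto (fun n : ℕ => 4 * D.Mn n ^ 2 * D.del n * Real.sqrt n) atTop atTop := by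
  obtain ⟨C, hC⟩ := hr.inv_le
  have hCp : 0 < max C 1 := by positivity
  have hs : 0 < (Real.sqrt (max C 1))⁻¹ := by positivity
  refine tendsto_atTop_mono' _ ?_ ((tendsto_Mn hr).atTop_mul_const hs)
  filter_upwards [hC, eventually_gt_atTop 0, (tendsto_Mn hr).eventually_ge_atTop 1]
    with n hn hn0 hM
  have hn0' : (0 : ℝ) < n := by exact_mod_cast hn0
  have h1 : 1 ≤ Real.sqrt (max C 1) * (D.del n * Real.sqrt n) := by
    have h2 : 1 ≤ max C 1 * D.del n ^ 2 * n := by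
      rw [div_le_iff₀ hn0'] at hn
      refine hn.trans ?_
      gcongr
      exact le_max_left _ _
    have h3 := Real.sqrt_le_sqrt h2
    rw [Real.sqrt_one, Real.sqrt_mul (by positivity), Real.sqrt_mul hCp.le,
      Real.sqrt_sq (hr.del_pos n).le, mul_assoc] at h3
    exact h3
  have h4 : (Real.sqrt (max C 1))⁻¹ ≤ D.del n * Real.sqrt n := by
    rw [inv_le_iff_one_le_mul₀' (by positivity)]
    exact h1
  have h5 : 0 ≤ D.del n * Real.sqrt n := hs.le.trans h4
  calc D.Mn n * (Real.sqrt (max C 1))⁻¹ ≤ D.Mn n * (D.del n * Real.sqrt n) := by gcongr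
    _ ≤ (4 * D.Mn n ^ 2) * (D.del n * Real.sqrt n) := by
        refine mul_le_mul_of_nonneg_right ?_ h5
        nlinarith
    _ = _ := by ring

/-! ### Consistency and rate of the unrestricted estimator -/

variable {C : LocalCurve 𝒳 𝒴 dθ H} {R : Procedure 𝒳 𝒴 dθ dρ H}

omit [StandardBorelSpace 𝒴] [Nonempty 𝒴] in
theorem penCrit_of_ne_top {n : ℕ} (hlam : 0 ≤ D.lam n) (z : Fin n → 𝒳 × 𝒴) {α : Param dθ H}
    (h : D.Pen α.2 ≠ ∞) :
    D.penCrit R n z α = ((Qhat R n z α + D.lam n * (D.Pen α.2).toReal : ℝ) : EReal) := by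
  rw [penCrit, EReal.coe_add]
  congr 1
  lift D.Pen α.2 to ℝ≥0 using h with q
  rw [ENNReal.coe_toReal, ← ENNReal.ofReal_coe_nnreal, ← ENNReal.ofReal_mul hlam,
    EReal.coe_ennreal_ofReal, max_eq_left (by positivity)]

theorem IsApproxMinimizer.eventually (hr : D.RateConditions) {S : ℕ → Set (Param dθ H)}
    {a : ∀ n, (Fin n → 𝒳 × 𝒴) → Param dθ H} (h : D.IsApproxMinimizer C R S a) {ε : ℝ}
    (hε : 0 < ε) : ∀ᶠ p in probFilter (sampleLaw C.P), a p.1 p.2 ∈ S p.1 ∧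
      ∀ α ∈ S p.1, D.Pen (a p.1 p.2).2 ≠ ∞ → D.Pen α.2 ≠ ∞ →
        Qhat R p.1 p.2 (a p.1 p.2) + D.lam p.1 * (D.Pen (a p.1 p.2).2).toReal
          ≤ Qhat R p.1 p.2 α + D.lam p.1 * (D.Pen α.2).toReal + ε / p.1 := by
  filter_upwards [eventually_probFilter_of_atTop h.1, (h.2 ε hε).eventually] with p h1 h2
  refine ⟨h1 _, fun α hα hfin hfin' => ?_⟩
  have h3 : ¬ _ := fun hlt => h2 ⟨α, hα, hlt⟩
  rw [not_lt, penCrit_of_ne_top (hr.lam_pos _).le _ hfin,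
    penCrit_of_ne_top (hr.lam_pos _).le _ hfin', ← EReal.coe_add, EReal.coe_le_coe_iff] at h3
  exact h3

/-- The basic inequality: the estimator is compared with `Π_n α_n`, whose penalized criterion is
`O_P(δ_n²)`. -/
theorem Qhat_est_le (hb : D.BasicConditions) (hr : D.RateConditions)
    {κ phi0 : ℝ} (hc : D.CurveConditions C κ) (hs : D.SampleConditions C R phi0) {a : ℕ → ℝ}
    (ha : Tendsto a atTop atTop) : ∀ᶠ p in probFilter (sampleLaw C.P),
      Qhat R p.1 p.2 (R.est p.1 p.2) ≤ a p.1 * D.del p.1 ^ 2 := by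
  obtain ⟨c0, hc0, hup⟩ := hs.upper
  obtain ⟨K, hK⟩ := hr.inv_le
  have ha2 : Tendsto (fun n => a n / 2) atTop atTop := ha.atTop_div_const (by norm_num)
  filter_upwards [hup.eventually (fun n => sq_nonneg _) ha2,
    hs.est_min.eventually hr one_pos, hs.est_Pen.eventually,
    eventually_probFilter_of_atTop hK, eventually_probFilter_of_atTop hr.lam_le,
    eventually_probFilter_of_atTop hc.mem_Nos, eventually_probFilter_of_atTop hc.Pen_proj,
    eventually_probFilter_of_atTop hc.Q_proj_le,
    -- One half of `a` absorbs the `O_P(δ_n²)` term. The other absorbs `c0` from the population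
    -- criterion, `M0` from the penalty and `K` from the minimization error `1 / n`.
    eventually_probFilter_of_atTop (ha2.eventually_ge_atTop (c0 + D.M0 + K))]
    with p h1 h2 h3 h4 h5 h6 h7 h8 h9
  have hmem : D.projA p.1 (D.point C p.1) ∈ D.Ak p.1 := ⟨h6.1, hb.proj_mem _ _⟩
  have h10 := h1 _ rfl
  have hfin : D.Pen (D.projA p.1 (D.point C p.1)).2 ≠ ∞ :=
    (h7.trans_lt ENNReal.coe_lt_top).ne
  have h11 := h2.2 _ hmem (ne_top_of_le_ne_top ENNReal.coe_ne_top h3) hfin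
  have h12 : (D.Pen (D.projA p.1 (D.point C p.1)).2).toReal ≤ D.M0 :=
    ENNReal.toReal_le_coe_of_le_coe h7
  have h13 : 0 ≤ D.lam p.1 * (D.Pen (R.est p.1 p.2).2).toReal :=
    mul_nonneg (hr.lam_pos _).le ENNReal.toReal_nonneg
  have h14 : D.lam p.1 * (D.Pen (D.projA p.1 (D.point C p.1)).2).toReal
      ≤ D.del p.1 ^ 2 * D.M0 := by
    gcongr
  have h15 : c0 * D.Q (C.P p.1) (D.projA p.1 (D.point C p.1)) ≤ c0 * D.del p.1 ^ 2 := by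
    gcongr
  have h16 : (c0 + D.M0 + K) * D.del p.1 ^ 2 ≤ a p.1 / 2 * D.del p.1 ^ 2 := by gcongr
  linarith

/-- Away from `α₀`, the criteria along the curve are uniformly bounded away from zero. -/
theorem exists_Q_lower_bound (hb : D.BasicConditions) (hr : D.RateConditions) {κ : ℝ}
    (hc : D.CurveConditions C κ) {r : ℝ} (hr0 : 0 < r) :
    ∃ b : ℝ, 0 < b ∧ ∀ᶠ n in atTop, ∀ α ∈ D.A, D.Pen α.2 ≤ D.M0 →
      r ≤ strongNorm (α - D.alpha0) → b < D.Q (C.P n) α := by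
  set K : Set (Param dθ H) :=
    (D.Theta ×ˢ {h | D.Pen h ≤ D.M0}) ∩ {α | r ≤ strongNorm (α - D.alpha0)} with hKdef
  have hK : IsCompact K := (hb.isCompact_Theta.prod (hr.Pen_lsc D.M0)).inter_right
    (isClosed_le continuous_const (continuous_strongNorm.comp (by fun_prop)))
  have key : ∃ b : ℝ, 0 < b ∧ ∀ᶠ n in atTop, ∀ α ∈ K, b < D.Q (C.P n) α := by
    -- Compactness makes the local bounds uniform: near each point of `K`, `lsc` bounds `Q_n` below
    -- by half of the positive value `Q_{P₀}(α)` for all large `n`, and finitely many such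
    -- neighbourhoods suffice.
    refine hK.induction_on (p := fun s => ∃ b : ℝ, 0 < b ∧ ∀ᶠ n in atTop, ∀ α ∈ s,
      α ∈ K → b < D.Q (C.P n) α) ?_ ?_ ?_ ?_ |>.imp fun b hb => ⟨hb.1, hb.2.mono
        fun n hn α hα => hn α hα hα⟩
    · exact ⟨1, one_pos, by simp⟩
    · rintro s t hst ⟨b, hb, h⟩
      exact ⟨b, hb, h.mono fun n hn α hα => hn α (hst hα)⟩
    · rintro s t ⟨b, hb, h⟩ ⟨b', hb', h'⟩
      refine ⟨min b b', lt_min hb hb', (h.and h').mono fun n hn α hα hαK => ?_⟩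
      rcases hα with hα | hα
      · exact (min_le_left _ _).trans_lt (hn.1 α hα hαK)
      · exact (min_le_right _ _).trans_lt (hn.2 α hα hαK)
    · intro α hα
      have hne : α ≠ D.alpha0 := by
        rintro rfl
        have := hα.2
        simp only [strongNorm, sub_self, Prod.fst_zero, Prod.snd_zero, norm_zero,
          Set.mem_ofPred_eq] at this
        linarith
      have hpos := Q_pos hb (show α ∈ D.A from hα.1.1) hne
      obtain ⟨s, hs, hev⟩ := hc.lsc α hα.1.1 (D.Q D.P0 α / 2) (by linarith)
      refine ⟨{β | strongNorm (β - α) < s}, mem_nhdsWithin_of_mem_nhds ?_, D.Q D.P0 α / 2,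
        by positivity, hev.mono fun n hn β hβ hβK => hn β hβK.1.1 hβ⟩
      refine (isOpen_lt (continuous_strongNorm.comp (by fun_prop)) continuous_const).mem_nhds ?_
      simpa [strongNorm] using hs
  obtain ⟨b, hb, h⟩ := key
  exact ⟨b, hb, h.mono fun n hn α h1 h2 h3 => hn α ⟨⟨h1, h2⟩, h3⟩⟩

/-- Consistency of the unrestricted estimator. -/
theorem eventually_strongNorm_est_lt (hb : D.BasicConditions) (hr : D.RateConditions)
    {κ phi0 : ℝ} (hc : D.CurveConditions C κ) (hs : D.SampleConditions C R phi0) {r : ℝ}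
    (hr0 : 0 < r) : ∀ᶠ p in probFilter (sampleLaw C.P),
      strongNorm (R.est p.1 p.2 - D.alpha0) < r := by
  obtain ⟨b, hb0, hQ⟩ := exists_Q_lower_bound hb hr hc hr0
  obtain ⟨c, hc0, hlow⟩ := hs.lower_global
  have hbar : ∀ n, 0 < D.delbar n := fun n => (hr.del_pos n).trans_le (hr.del_le n)
  -- With the diverging factor `1 / δ̄_n` both errors are at most `δ̄_n`, which still tends to zero
  -- and so falls below `c * b / 2`.
  have ha : Tendsto (fun n => (D.delbar n)⁻¹) atTop atTop :=
    tendsto_inv_nhdsGT_zero.comp (tendsto_nhdsWithin_iff.2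
      ⟨hr.delbar_tendsto, Eventually.of_forall hbar⟩)
  filter_upwards [hlow.eventually (fun n => sq_nonneg _) ha, Qhat_est_le hb hr hc hs ha,
    eventually_probFilter_of_atTop hQ, hs.est_Pen.eventually,
    eventually_probFilter_of_atTop hs.est_min.1,
    eventually_probFilter_of_atTop (hr.delbar_tendsto.eventually_lt_const
      (show 0 < c * b / 2 by positivity))] with p h1 h2 h3 h4 h5 h6
  by_contra! hcon
  have h7 := h1 _ ⟨h5 p.2, h4⟩
  have h8 := h3 _ (h5 p.2).1 h4 hcon
  have h9 : (D.delbar p.1)⁻¹ * D.delbar p.1 ^ 2 = D.delbar p.1 := by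
    have := (hbar p.1).ne'
    field_simp
  have h10 : (D.delbar p.1)⁻¹ * D.del p.1 ^ 2 ≤ (D.delbar p.1)⁻¹ * D.delbar p.1 ^ 2 := by
    have := hr.del_le p.1
    have := (hr.del_pos p.1).le
    have := (hbar p.1)
    gcongr
  have h11 : c * b < c * D.Q (C.P p.1) (R.est p.1 p.2) := by gcongr
  linarith

/-- The unrestricted estimator belongs to the local parameter space. -/
theorem eventually_est_mem_Nosn (hb : D.BasicConditions) (hr : D.RateConditions)
    (hl : D.LocalConditions) {κ phi0 : ℝ} (hc : D.CurveConditions C κ)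
    (hs : D.SampleConditions C R phi0) :
    ∀ᶠ p in probFilter (sampleLaw C.P), R.est p.1 p.2 ∈ D.Nosn p.1 := by
  obtain ⟨r, hr0, hAos⟩ := hl.Aos_nhd
  obtain ⟨c, hc0, hlow⟩ := hs.lower_local
  obtain ⟨c1, K1, hc1, hcurv⟩ := hc.curvature
  obtain ⟨c2, hc2, hweak⟩ := hc.weak_bound
  obtain ⟨c3, K3, hc3, hcurv0⟩ := hl.curvature
  have hM := tendsto_Mn hr
  -- The slack left by `c2 < 1` is halved. One share bounds the distance from the estimator to
  -- `α_n`, giving `(1 - g) M_n δ_n` for the distance to `α₀` since `g + c2 = 1 - g`. The other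
  -- bounds the sieve error of `Π_n α₀`.
  set g := (1 - c2) / 2 with hg
  have hgpos : 0 < g := by rw [hg]; linarith
  -- The sample bounds give `c * c1 * ‖α̂ - α_n‖² ≤ 2 M_n δ_n²`. Since this is linear in `M_n`, it
  -- is below `(g M_n δ_n)²` once `M_n ≥ K / g²`.
  set K := 2 / (c * c1) with hK
  have hKpos : 0 < K := by positivity
  set K2 := Real.sqrt (1 / c3) with hK2
  have hα0 := alpha0_mem_V hb hr hl
  filter_upwards [hlow.eventually (fun n => sq_nonneg _) hM, Qhat_est_le hb hr hc hs hM,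
    eventually_strongNorm_est_lt hb hr hc hs hr0, hs.est_Pen.eventually,
    eventually_probFilter_of_atTop hs.est_min.1, eventually_probFilter_of_atTop hcurv,
    eventually_probFilter_of_atTop hweak, eventually_probFilter_of_atTop hr.Q_proj_le,
    eventually_probFilter_of_atTop (eventually_projA_mem_Aos hb hr hl),
    eventually_probFilter_of_atTop (hM.eventually_ge_atTop 1),
    eventually_probFilter_of_atTop (hM.eventually_ge_atTop (K / g ^ 2)),
    eventually_probFilter_of_atTop (hM.eventually_ge_atTop (K2 / g))]
    with p h1 h2 h3 h4 h5 h6 h7 h8 h9 hM1 hM2 hM3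
  have hAk := h5 p.2
  have hmemA : R.est p.1 p.2 ∈ D.Aos := hAos _ hAk.1 h3 h4
  have hV : R.est p.1 p.2 ∈ D.V := hl.Vn_le _ (Ak_subset_Vn hAk)
  have hdel := hr.del_pos p.1
  have hpV : D.projA p.1 D.alpha0 ∈ D.V := hl.Vn_le _ (projA_mem_Vn hb _ _)
  have hDV : C.Delta p.1 ∈ D.V := hl.Vn_le _ (hc.Delta_mem _)
  have hdDV := D.V.smul_mem (C.d p.1) hDV
  have e1 := h1 _ ⟨hmemA, hAk⟩
  have e2 := (h6 _ hmemA).1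
  have hsq : D.weakNorm (R.est p.1 p.2 - D.point C p.1) ^ 2
      ≤ (g * D.Mn p.1 * D.del p.1) ^ 2 := by
    have e3 : D.weakNorm (R.est p.1 p.2 - D.point C p.1) ^ 2 ≤ K * (D.Mn p.1 * D.del p.1 ^ 2) := by
      rw [hK, div_mul_eq_mul_div, le_div_iff₀ (by positivity)]
      nlinarith
    have e4 : K ≤ g ^ 2 * D.Mn p.1 := by
      rw [div_le_iff₀ (by positivity)] at hM2
      linarith
    calc _ ≤ _ := e3
      _ ≤ g ^ 2 * D.Mn p.1 * (D.Mn p.1 * D.del p.1 ^ 2) := by gcongr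
      _ = _ := by ring
  have e5 : D.weakNorm (R.est p.1 p.2 - D.point C p.1) ≤ g * D.Mn p.1 * D.del p.1 :=
    le_of_abs_le (abs_le_of_sq_le_sq hsq (by positivity))
  have e6 : R.est p.1 p.2 - D.alpha0
      = (R.est p.1 p.2 - D.point C p.1) + C.d p.1 • C.Delta p.1 := by
    rw [point]; abel
  have hpointV : D.point C p.1 ∈ D.V := D.V.add_mem hα0 hdDV
  have e7 : D.weakNorm (R.est p.1 p.2 - D.alpha0) ≤ (1 - g) * D.Mn p.1 * D.del p.1 := by
    rw [e6]
    refine (weakNorm_add_le hb hl (D.V.sub_mem hV hpointV) hdDV).trans ?_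
    rw [weakNorm_smul hb hl hDV, abs_of_nonneg (hc.d_nonneg _)]
    have : (1 - g) * D.Mn p.1 * D.del p.1
        = g * D.Mn p.1 * D.del p.1 + c2 * (D.Mn p.1 * D.del p.1) := by
      rw [hg]; ring
    rw [this]
    exact add_le_add e5 h7
  have e8 : D.weakNorm (D.projA p.1 D.alpha0 - D.alpha0) ≤ g * D.Mn p.1 * D.del p.1 := by
    have f1 := (hcurv0 _ h9).1.trans h8
    have f2 : D.weakNorm (D.projA p.1 D.alpha0 - D.alpha0) ^ 2 ≤ (K2 * D.del p.1) ^ 2 := by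
      rw [mul_pow, hK2, Real.sq_sqrt (by positivity), one_div_mul_eq_div, le_div_iff₀ hc3]
      linarith
    have f3 := le_of_abs_le (abs_le_of_sq_le_sq f2 (by positivity))
    refine f3.trans ?_
    rw [div_le_iff₀ hgpos] at hM3
    gcongr
    linarith
  -- The ratio `τ_n` is taken relative to `Π_n α₀`, so the weak bound must be recentred there before
  -- it becomes a strong one.
  have e9 : D.weakNorm (R.est p.1 p.2 - D.projA p.1 D.alpha0) ≤ D.Mn p.1 * D.del p.1 := by
    have f1 : R.est p.1 p.2 - D.projA p.1 D.alpha0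
      = (R.est p.1 p.2 - D.alpha0) + (D.alpha0 - D.projA p.1 D.alpha0) := by abel
    have f2 := weakNorm_add_le hb hl (D.V.sub_mem hV hα0) (D.V.sub_mem hα0 hpV)
    rw [← f1, weakNorm_sub_comm hb hl (D.V.sub_mem hpV hα0)] at f2
    nlinarith
  refine ⟨⟨hAk.1, e7.trans ?_, ?_, h4⟩, hAk⟩
  · have : 0 ≤ g * D.Mn p.1 * D.del p.1 := by positivity
    nlinarith
  · have f1 : R.est p.1 p.2 - D.alpha0
      = (R.est p.1 p.2 - D.projA p.1 D.alpha0) + (D.projA p.1 D.alpha0 - D.alpha0) := by abel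
    have f2 := strongNorm_le_tau_mul hb hl (α := R.est p.1 p.2) ⟨hmemA, hAk⟩
    have f3 : strongNorm (D.projA p.1 D.alpha0 - D.alpha0)
        = ‖D.alpha0.2 - D.proj p.1 D.alpha0.2‖ := by
      simp [strongNorm, projA, norm_sub_rev]
    have f4 := strongNorm_add_le (R.est p.1 p.2 - D.projA p.1 D.alpha0)
      (D.projA p.1 D.alpha0 - D.alpha0)
    rw [← f1, f3] at f4
    have f5 : D.tau p.1 * D.weakNorm (R.est p.1 p.2 - D.projA p.1 D.alpha0)
        ≤ D.tau p.1 * (D.Mn p.1 * D.del p.1) := mul_le_mul_of_nonneg_left e9 (tau_nonneg _)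
    rw [delS]
    have f6 : ‖D.alpha0.2 - D.proj p.1 D.alpha0.2‖
        ≤ D.Mn p.1 * ‖D.alpha0.2 - D.proj p.1 D.alpha0.2‖ :=
      le_mul_of_one_le_left (norm_nonneg _) hM1
    linarith

end Design

/-! ### Linearized functional and quadratic expansion along local paths -/

namespace Design

variable {𝒳 𝒴 H : Type*} [MeasurableSpace 𝒳] [MeasurableSpace 𝒴] [StandardBorelSpace 𝒴]
  [Nonempty 𝒴] {dθ dρ : ℕ} [NormedAddCommGroup H] [NormedSpace ℝ H]

/-- The standing assumptions of the local asymptotic analysis. -/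
structure LocalSetting (D : Design 𝒳 𝒴 dθ dρ H) (C : LocalCurve 𝒳 𝒴 dθ H)
    (R : Procedure 𝒳 𝒴 dθ dρ H) (v a0 : ℕ → Param dθ H) (B : ∀ n, (Fin n → 𝒳 × 𝒴) → ℝ)
    (κ phi0 : ℝ) : Prop where
  null : D.phi D.alpha0 = phi0
  riesz : D.IsSieveRiesz v
  projection : D.IsWeakProjection a0
  basic : D.BasicConditions
  rate : D.RateConditions
  localc : D.LocalConditions
  penalty : D.PenaltyNegligible v
  functional : D.FunctionalConditions v a0
  curve : D.CurveConditions C κ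
  sample : D.SampleConditions C R phi0
  quadratic : D.LocalQuadratic C R v B

variable {D : Design 𝒳 𝒴 dθ dρ H} {C : LocalCurve 𝒳 𝒴 dθ H} {R : Procedure 𝒳 𝒴 dθ dρ H}
  {v a0 : ℕ → Param dθ H} {B : ∀ n, (Fin n → 𝒳 × 𝒴) → ℝ} {κ phi0 : ℝ}

/-- The drift `√n ⟨u_n, d_n Δ_n⟩` of the local curve. -/
noncomputable def drift (D : Design 𝒳 𝒴 dθ dρ H) (C : LocalCurve 𝒳 𝒴 dθ H)
    (v : ℕ → Param dθ H) (n : ℕ) : ℝ :=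
  Real.sqrt n * (C.d n * D.weakInner (D.scaled (v n)) (C.Delta n))

/-- The scaled deviation `√n ⟨u_n, α - α₀⟩`. -/
noncomputable def deviation (D : Design 𝒳 𝒴 dθ dρ H) (v : ℕ → Param dθ H) (n : ℕ)
    (α : Param dθ H) : ℝ :=
  Real.sqrt n * D.weakInner (D.scaled (v n)) (α - D.alpha0)

namespace LocalSetting

variable (h : LocalSetting D C R v a0 B κ phi0)

include h

theorem riesz_mem_V (n : ℕ) : v n ∈ D.V :=
  h.localc.Vn_le n (h.riesz n).1

theorem scaled_mem_Vn (n : ℕ) : D.scaled (v n) ∈ D.Vn n :=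
  (D.Vn n).smul_mem _ (h.riesz n).1

theorem scaled_mem_V (n : ℕ) : D.scaled (v n) ∈ D.V :=
  h.localc.Vn_le n (h.scaled_mem_Vn n)

theorem weakInner_scaled {n : ℕ} {w : Param dθ H} (hw : w ∈ D.V) :
    D.weakInner (D.scaled (v n)) w = (D.sdNorm (v n))⁻¹ * D.weakInner (v n) w :=
  weakInner_smul_left h.basic h.localc (h.riesz_mem_V n) hw _

/-- The limit `dφ(Δ_n) → κ ≠ 0` excludes a degenerate representer: a vanishing `‖v_n‖` would give
`dφ(Δ_n) = ⟨v_n, Δ_n⟩ = 0`. The rest is the equivalence of the two norms. -/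
theorem exists_scaled_bounds : ∃ c K : ℝ, 0 < c ∧ 0 < K ∧ ∀ᶠ n in atTop, 0 < D.sdNorm (v n) ∧
    c ≤ D.weakNorm (D.scaled (v n)) ^ 2 ∧ D.weakNorm (D.scaled (v n)) ^ 2 ≤ K := by
  obtain ⟨c, K, hc, hK, hsd⟩ := exists_sdNorm_bounds h.basic h.localc
  refine ⟨1 / K, 1 / c, by positivity, by positivity, ?_⟩
  filter_upwards [h.curve.dphi_tendsto.eventually_ne h.curve.kappa_ne] with n hn
  have hv := h.riesz_mem_V n
  have hpos : 0 < D.weakNorm (v n) := by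
    refine (weakNorm_nonneg _).lt_of_ne' fun h0 => hn ?_
    rw [(h.riesz n).2 _ (h.curve.Delta_mem n)]
    have := abs_weakInner_le h.basic h.localc hv (h.localc.Vn_le n (h.curve.Delta_mem n))
    rw [h0, zero_mul] at this
    exact abs_nonpos_iff.1 this
  obtain ⟨h1, h2⟩ := hsd _ hv
  have hsdpos : 0 < D.sdNorm (v n) := by
    refine (sdNorm_nonneg _).lt_of_ne' fun h0 => ?_
    rw [h0] at h1
    have : 0 < c * D.weakNorm (v n) ^ 2 := by positivity
    linarith
  have heq : D.weakNorm (D.scaled (v n)) ^ 2 = D.weakNorm (v n) ^ 2 / D.sdNorm (v n) ^ 2 := by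
    rw [Model.scaled, weakNorm_smul h.basic h.localc hv, mul_pow, sq_abs, inv_pow, inv_mul_eq_div]
  refine ⟨hsdpos, ?_, ?_⟩ <;> rw [heq]
  · rw [div_le_div_iff₀ hK (by positivity)]
    linarith
  · rw [div_le_div_iff₀ (by positivity) hc]
    linarith

/-- This form separates the two regimes: the factor in front of `dφ(Δ_n)` is `1` in the first and
diverges in the second. -/
theorem drift_eq (n : ℕ) :
    drift D C v n = Real.sqrt n * C.d n / D.sdNorm (v n) * D.dphi (C.Delta n) := by
  rw [drift, h.weakInner_scaled (h.localc.Vn_le n (h.curve.Delta_mem n)),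
    (h.riesz n).2 _ (h.curve.Delta_mem n)]
  ring

theorem sqrt_mul_weakInner_sub_point {n : ℕ} {α : Param dθ H} (hα : α ∈ D.V) :
    Real.sqrt n * D.weakInner (D.scaled (v n)) (α - D.point C n)
      = deviation D v n α - drift D C v n := by
  have hα0 := alpha0_mem_V h.basic h.rate h.localc
  have hΔ := h.localc.Vn_le n (h.curve.Delta_mem n)
  have : α - D.point C n = (α - D.alpha0) - C.d n • C.Delta n := by rw [point]; abel
  rw [this, weakInner_sub_right h.basic h.localc (D.V.sub_mem hα hα0) (D.V.smul_mem _ hΔ)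
    (h.scaled_mem_V n), weakInner_smul_right h.basic h.localc hΔ (h.scaled_mem_V n), deviation,
    drift]
  ring

theorem Nosn_subset_V {n : ℕ} {α : Param dθ H} (hα : α ∈ D.Nosn n) : α ∈ D.V :=
  h.localc.Vn_le n (Ak_subset_Vn hα.2)

theorem zero_mem_T (n : ℕ) : (0 : ℝ) ∈ D.T n := by
  have := (h.rate.del_pos n).le
  simp only [T, Set.mem_ofPred_eq, abs_zero]
  positivity

/-- Uniform linearization of the functional along the paths `α + t u_n`. -/
theorem functional_expansion {ε : ℝ} (hε : 0 < ε) : ∀ᶠ n : ℕ in atTop, ∀ α ∈ D.Nosn n,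
    ∀ t ∈ D.T n, |Real.sqrt n * ((D.phi (α + t • D.scaled (v n)) - phi0) / D.sdNorm (v n))
      - deviation D v n α - Real.sqrt n * t * D.weakNorm (D.scaled (v n)) ^ 2| ≤ ε := by
  obtain ⟨c, K, hc, hK, hU⟩ := h.exists_scaled_bounds
  obtain ⟨L, hL⟩ := h.functional.derivative
  have hdphi : ∀ w, D.dphi w = L w := fun w => (hL w).deriv
  have hα0 := alpha0_mem_V h.basic h.rate h.localc
  -- Nonlinearity and bias each cost `η ‖v_n‖`, and `‖v_n‖ ≤ √K ‖v_n‖_sd`.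
  set η := ε / (2 * (Real.sqrt K + 1)) with hη
  have hηpos : 0 < η := by positivity
  filter_upwards [hU, h.functional.nonlinearity η hηpos, h.functional.bias η hηpos]
    with n ⟨hsd, hU1, hU2⟩ hnl hbias α hα t ht
  have hαV := h.Nosn_subset_V hα
  have haV := h.localc.Vn_le n (h.projection n).1
  have huV := h.scaled_mem_V n
  have hvV := h.riesz_mem_V n
  -- The Riesz identity holds only on the sieve tangent space, which need not contain `α₀`.
  -- Inserting the weak projection `a0 n` repairs this: `a0 n - α₀` is orthogonal to `v_n`, so the
  -- inner product is unchanged, and what remains is the bias term.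
  have e1 : D.dphi (α + t • D.scaled (v n) - D.alpha0)
      = D.weakInner (v n) (α - D.alpha0) + t * D.weakInner (v n) (D.scaled (v n))
        + D.dphi (a0 n - D.alpha0) := by
    have f1 : α + t • D.scaled (v n) - D.alpha0
        = (α + t • D.scaled (v n) - a0 n) + (a0 n - D.alpha0) := by abel
    have f2 : α + t • D.scaled (v n) - a0 n
        = (α - D.alpha0) + t • D.scaled (v n) - (a0 n - D.alpha0) := by abel
    have f3 : α + t • D.scaled (v n) - a0 n ∈ D.Vn n :=
      (D.Vn n).sub_mem ((D.Vn n).add_mem (Ak_subset_Vn hα.2)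
        ((D.Vn n).smul_mem _ (h.scaled_mem_Vn n))) (h.projection n).1
    rw [f1, hdphi, map_add, ← hdphi, ← hdphi, (h.riesz n).2 _ f3, f2,
      weakInner_sub_right h.basic h.localc (D.V.add_mem (D.V.sub_mem hαV hα0)
        (D.V.smul_mem t huV)) (D.V.sub_mem haV hα0) hvV,
      weakInner_add_right h.basic h.localc (D.V.sub_mem hαV hα0) (D.V.smul_mem t huV) hvV,
      weakInner_smul_right h.basic h.localc huV hvV,
      weakInner_projection_eq_zero h.basic h.rate h.localc h.projection (h.riesz n).1]
    ring
  have e2 : D.weakNorm (D.scaled (v n)) ^ 2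
      = (D.sdNorm (v n))⁻¹ * D.weakInner (v n) (D.scaled (v n)) := by
    rw [weakNorm_sq h.basic, h.weakInner_scaled huV]
  have e3 : D.weakNorm (v n) / D.sdNorm (v n) ≤ Real.sqrt K := by
    have f1 : D.weakNorm (D.scaled (v n)) = D.weakNorm (v n) / D.sdNorm (v n) := by
      rw [Model.scaled, weakNorm_smul h.basic h.localc hvV, abs_of_pos (inv_pos.2 hsd),
        inv_mul_eq_div]
    rw [← f1]
    exact Real.le_sqrt_of_sq_le hU2
  have e4 := hnl α hα t ht
  rw [h.null, e1] at e4
  rw [deviation, e2, h.weakInner_scaled (D.V.sub_mem hαV hα0)]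
  have e5 : Real.sqrt n * ((D.phi (α + t • D.scaled (v n)) - phi0) / D.sdNorm (v n))
      - Real.sqrt n * ((D.sdNorm (v n))⁻¹ * D.weakInner (v n) (α - D.alpha0))
      - Real.sqrt n * t * ((D.sdNorm (v n))⁻¹ * D.weakInner (v n) (D.scaled (v n)))
      = (Real.sqrt n * (D.phi (α + t • D.scaled (v n)) - phi0 -
          (D.weakInner (v n) (α - D.alpha0) + t * D.weakInner (v n) (D.scaled (v n))
            + D.dphi (a0 n - D.alpha0))) + Real.sqrt n * D.dphi (a0 n - D.alpha0))
          / D.sdNorm (v n) := by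
    field_simp
    ring
  rw [e5, abs_div, abs_of_pos hsd, div_le_iff₀ hsd]
  refine (abs_add_le _ _).trans ?_
  rw [abs_mul, abs_mul, abs_of_nonneg (Real.sqrt_nonneg _)]
  rw [div_le_iff₀ hsd] at e3
  calc _ ≤ η * D.weakNorm (v n) + η * D.weakNorm (v n) := add_le_add e4 hbias
    _ = 2 * η * D.weakNorm (v n) := by ring
    _ ≤ 2 * η * (Real.sqrt K * D.sdNorm (v n)) := by gcongr
    _ ≤ 2 * η * ((Real.sqrt K + 1) * D.sdNorm (v n)) := by gcongr; linarith
    _ = ε * D.sdNorm (v n) := by rw [hη]; field_simp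

/-- Every local parameter can be moved along `u_n` into the null hypothesis. -/
theorem exists_path_null : ∀ᶠ n : ℕ in atTop, ∀ α ∈ D.Nosn n,
    ∃ t ∈ D.T n, D.phi (α + t • D.scaled (v n)) = phi0 := by
  obtain ⟨c, K, hc, hK, hU⟩ := h.exists_scaled_bounds
  have hM := tendsto_Mn h.rate
  filter_upwards [hU, h.functional_expansion one_pos, eventually_gt_atTop 0,
    hM.eventually_ge_atTop 1, hM.eventually_ge_atTop (Real.sqrt K / (2 * c)),
    (tendsto_radius h.rate).eventually_ge_atTop (2 / c)]
    with n ⟨hsd, hU1, hU2⟩ hexp hn hM1 hM2 hrad α hα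
  have hdel := h.rate.del_pos n
  -- At the end points `±ρ` of `T_n` the linear term has size at least `√n ρ c`. Half of this
  -- dominates the deviation of `α` and the other half the expansion error `1`, so `φ - φ₀` takes
  -- opposite signs, possibly zero.
  set ρ := 4 * D.Mn n ^ 2 * D.del n with hρ
  have hρ0 : 0 ≤ ρ := by positivity
  have hαV := h.Nosn_subset_V hα
  have hα0 := alpha0_mem_V h.basic h.rate h.localc
  have hdev : |deviation D v n α| ≤ Real.sqrt n * (ρ * c / 2) := by
    rw [deviation, abs_mul, abs_of_nonneg (Real.sqrt_nonneg _)]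
    refine mul_le_mul_of_nonneg_left ?_ (Real.sqrt_nonneg _)
    calc _ ≤ D.weakNorm (D.scaled (v n)) * D.weakNorm (α - D.alpha0) :=
          abs_weakInner_le h.basic h.localc (h.scaled_mem_V n) (D.V.sub_mem hαV hα0)
      _ ≤ Real.sqrt K * (D.Mn n * D.del n) :=
          mul_le_mul (Real.le_sqrt_of_sq_le hU2) hα.1.2.1 (weakNorm_nonneg _)
            (Real.sqrt_nonneg _)
      _ ≤ (D.Mn n * (2 * c)) * (D.Mn n * D.del n) := by
          rw [div_le_iff₀ (by positivity)] at hM2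
          gcongr
      _ = ρ * c / 2 := by rw [hρ]; ring
  have hsn : 0 < Real.sqrt n := Real.sqrt_pos.2 (by exact_mod_cast hn)
  have hbig : 1 ≤ Real.sqrt n * (ρ * c / 2) := by
    rw [div_le_iff₀ hc] at hrad
    linarith
  have hUρ : Real.sqrt n * (ρ * c) ≤ Real.sqrt n * ρ * D.weakNorm (D.scaled (v n)) ^ 2 := by
    rw [← mul_assoc]
    gcongr
  have hdev' := abs_le.1 hdev
  have hmem : ∀ t, |t| ≤ ρ → t ∈ D.T n := fun t ht => ht
  have hright : phi0 ≤ D.phi (α + ρ • D.scaled (v n)) := by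
    have e1 := (abs_le.1 (hexp α hα ρ (hmem _ (abs_of_nonneg hρ0).le))).1
    have e2 : 0 ≤ Real.sqrt n * ((D.phi (α + ρ • D.scaled (v n)) - phi0) / D.sdNorm (v n)) := by
      linarith [hdev'.1]
    have e3 := nonneg_of_mul_nonneg_right e2 hsn
    have e4 := mul_nonneg e3 hsd.le
    rw [div_mul_cancel₀ _ hsd.ne'] at e4
    linarith
  have hleft : D.phi (α + (-ρ) • D.scaled (v n)) ≤ phi0 := by
    have e1 := (abs_le.1 (hexp α hα (-ρ) (hmem _ (by rw [abs_neg, abs_of_nonneg hρ0])))).2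
    have e2 : 0 ≤ Real.sqrt n *
        ((phi0 - D.phi (α + (-ρ) • D.scaled (v n))) / D.sdNorm (v n)) := by
      have : Real.sqrt n * ((phi0 - D.phi (α + (-ρ) • D.scaled (v n))) / D.sdNorm (v n))
        = -(Real.sqrt n * ((D.phi (α + (-ρ) • D.scaled (v n)) - phi0) / D.sdNorm (v n))) := by
        ring
      rw [this]
      linarith [hdev'.2]
    have e3 := nonneg_of_mul_nonneg_right e2 hsn
    have e4 := mul_nonneg e3 hsd.le
    rw [div_mul_cancel₀ _ hsd.ne'] at e4
    linarith
  have hcont : Continuous fun t : ℝ => D.phi (α + t • D.scaled (v n)) :=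
    h.functional.continuous_phi.comp (by fun_prop)
  obtain ⟨t, ht, hteq⟩ := intermediate_value_Icc (by linarith : -ρ ≤ ρ) hcont.continuousOn
    ⟨hleft, hright⟩
  exact ⟨t, hmem t (abs_le.2 ht), hteq⟩

/-- Approximate minimizers in the local parameter space minimize the unpenalized criterion over
the local paths. -/
theorem eventually_Qhat_le {S : ℕ → Set (Param dθ H)}
    {a : ∀ n, (Fin n → 𝒳 × 𝒴) → Param dθ H} (hmin : D.IsApproxMinimizer C R S a)
    (hmem : ∀ᶠ p in probFilter (sampleLaw C.P), a p.1 p.2 ∈ D.Nosn p.1) {ε : ℝ} (hε : 0 < ε) :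
    ∀ᶠ p in probFilter (sampleLaw C.P), ∀ α ∈ D.Nosn p.1, ∀ t ∈ D.T p.1,
      α + t • D.scaled (v p.1) ∈ S p.1 →
      p.1 * Qhat R p.1 p.2 (a p.1 p.2)
        ≤ p.1 * Qhat R p.1 p.2 (α + t • D.scaled (v p.1)) + ε := by
  filter_upwards [hmin.eventually h.rate (half_pos hε), hmem,
    eventually_probFilter_of_atTop (h.penalty (ε / 2) (half_pos hε)),
    eventually_probFilter_of_atTop (eventually_gt_atTop 0)] with p h1 h2 h3 hn α hα t ht hS
  have hlam := h.rate.lam_pos p.1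
  have hn' : (0 : ℝ) < p.1 := by exact_mod_cast hn
  have hpath : ∀ γ ∈ D.Nosn p.1, ∀ t ∈ D.T p.1, γ + t • D.scaled (v p.1) ∈ D.Aos ∪
      {β | ∃ γ ∈ D.Nosn p.1, ∃ t ∈ D.T p.1, β = γ + t • D.scaled (v p.1)} :=
    fun γ hγ t ht => Or.inr ⟨γ, hγ, t, ht, rfl⟩
  have ha : a p.1 p.2 ∈ D.Aos ∪
      {β | ∃ γ ∈ D.Nosn p.1, ∃ t ∈ D.T p.1, β = γ + t • D.scaled (v p.1)} := by
    simpa using hpath _ h2 0 (h.zero_mem_T _)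
  have hafin : D.Pen (a p.1 p.2).2 ≠ ∞ := ne_top_of_le_ne_top ENNReal.coe_ne_top h2.1.2.2.2
  have h4 := h3 _ (hpath α hα t ht) _ ha
  have hfin' : ENNReal.ofReal (D.lam p.1) * D.Pen (a p.1 p.2).2 +
      ENNReal.ofReal (ε / 2 / p.1) ≠ ∞ :=
    ENNReal.add_ne_top.2 ⟨ENNReal.mul_ne_top ENNReal.ofReal_ne_top hafin, ENNReal.ofReal_ne_top⟩
  -- Since `λ_n > 0`, an infinite penalty on the path would contradict its comparison with the
  -- finite penalty at `a`.
  have hfin : D.Pen (α + t • D.scaled (v p.1)).2 ≠ ∞ := by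
    intro htop
    rw [htop, ENNReal.mul_top (by simpa using hlam)] at h4
    exact hfin' (top_le_iff.1 h4)
  have h5 := ENNReal.toReal_mono hfin' h4
  rw [ENNReal.toReal_add (ENNReal.mul_ne_top ENNReal.ofReal_ne_top hafin) ENNReal.ofReal_ne_top,
    ENNReal.toReal_mul, ENNReal.toReal_mul, ENNReal.toReal_ofReal hlam.le,
    ENNReal.toReal_ofReal (by positivity)] at h5
  have h6 := h1.2 _ hS hafin hfin
  have h7 : Qhat R p.1 p.2 (a p.1 p.2)
      ≤ Qhat R p.1 p.2 (α + t • D.scaled (v p.1)) + ε / p.1 := by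
    have : ε / (p.1 : ℝ) = ε / 2 / p.1 + ε / 2 / p.1 := by ring
    linarith
  calc _ ≤ (p.1 : ℝ) * (Qhat R p.1 p.2 (α + t • D.scaled (v p.1)) + ε / p.1) := by gcongr
    _ = _ := by field_simp

/-- The quadratic expansion of the criterion along local paths, in the `n^{-1/2}` scale. -/
theorem isLittleO_expansion {α : (Σ n, Fin n → 𝒳 × 𝒴) → Param dθ H}
    {s : (Σ n, Fin n → 𝒳 × 𝒴) → ℝ}
    (hα : ∀ᶠ p in probFilter (sampleLaw C.P), α p ∈ D.Nosn p.1)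
    (hs : ∀ᶠ p in probFilter (sampleLaw C.P), s p / Real.sqrt p.1 ∈ D.T p.1) :
    (fun p => p.1 * Qhat R p.1 p.2 (α p + (s p / Real.sqrt p.1) • D.scaled (v p.1))
        - p.1 * Qhat R p.1 p.2 (α p)
        - 2 * s p * (Real.sqrt p.1 * D.scoreAvg C v p.1 p.2 + deviation D v p.1 (α p)
          - drift D C v p.1) - B p.1 p.2 * s p ^ 2)
      =o[probFilter (sampleLaw C.P)] fun p => s p ^ 2 + 1 := by
  obtain ⟨e, he0, he, hexp⟩ := h.quadratic.expansion
  rw [Asymptotics.isLittleO_iff]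
  intro c hc
  filter_upwards [hα, hs, (hexp (c / 2) (half_pos hc)).eventually,
    eventually_probFilter_of_atTop (eventually_gt_atTop 0),
    eventually_probFilter_of_atTop (he.eventually_le_const one_pos)] with p h1 h2 h3 hn he1
  have hn' : (0 : ℝ) < p.1 := by exact_mod_cast hn
  have hsn : 0 < Real.sqrt p.1 := Real.sqrt_pos.2 hn'
  have hsq : Real.sqrt p.1 * Real.sqrt p.1 = p.1 := Real.mul_self_sqrt hn'.le
  have h4 : ¬ _ := fun hlt => h3 ⟨α p, h1, s p / Real.sqrt p.1, h2, hlt⟩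
  rw [not_lt] at h4
  have h5 := h.sqrt_mul_weakInner_sub_point (n := p.1) (h.Nosn_subset_V h1)
  rw [Real.norm_eq_abs, Real.norm_of_nonneg (by positivity : 0 ≤ s p ^ 2 + 1)]
  set q := s p / Real.sqrt p.1 with hq
  have hqs : s p = q * Real.sqrt p.1 := by rw [hq]; field_simp
  have h6 : p.1 * Qhat R p.1 p.2 (α p + q • D.scaled (v p.1)) - p.1 * Qhat R p.1 p.2 (α p)
        - 2 * s p * (Real.sqrt p.1 * D.scoreAvg C v p.1 p.2 + deviation D v p.1 (α p)
          - drift D C v p.1) - B p.1 p.2 * s p ^ 2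
      = 2 * p.1 * ((Qhat R p.1 p.2 (α p + q • D.scaled (v p.1)) - Qhat R p.1 p.2 (α p)) / 2
            - q * (D.scoreAvg C v p.1 p.2
              + D.weakInner (D.scaled (v p.1)) (α p - D.point C p.1))
            - B p.1 p.2 / 2 * q ^ 2) := by
    rw [add_sub_assoc, ← h5, ← mul_add, hqs]
    linear_combination (-2 * q * (D.scoreAvg C v p.1 p.2
      + D.weakInner (D.scaled (v p.1)) (α p - D.point C p.1)) - B p.1 p.2 * q ^ 2) * hsq
  rw [h6, abs_mul, abs_of_pos (by positivity : (0 : ℝ) < 2 * p.1)]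
  -- With `t = s / √n`, the three terms of the remainder scale times `n` are `s²`, `|s|` and `n e_n
  -- ≤ 1`.
  have h7 : (p.1 : ℝ) * max (q ^ 2) (max (|q| / Real.sqrt p.1) (e p.1)) ≤ s p ^ 2 + 1 := by
    rw [mul_max_of_nonneg _ _ hn'.le, mul_max_of_nonneg _ _ hn'.le]
    have f1 : p.1 * q ^ 2 = s p ^ 2 := by rw [hqs, mul_pow, Real.sq_sqrt hn'.le]; ring
    have f2 : p.1 * (|q| / Real.sqrt p.1) = |s p| := by
      rw [hqs, abs_mul, abs_of_pos hsn]
      calc _ = Real.sqrt p.1 * Real.sqrt p.1 * (|q| / Real.sqrt p.1) := by rw [hsq]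
        _ = _ := by field_simp
    refine max_le (by linarith) (max_le ?_ (by nlinarith [sq_nonneg (s p)]))
    rw [f2]
    nlinarith [sq_nonneg (|s p| - 1), sq_abs (s p), abs_nonneg (s p)]
  calc _ ≤ 2 * (p.1 : ℝ) * (c / 2 * max (q ^ 2) (max (|q| / Real.sqrt p.1) (e p.1))) := by
        gcongr
    _ = c * (p.1 * max (q ^ 2) (max (|q| / Real.sqrt p.1) (e p.1))) := by ring
    _ ≤ c * (s p ^ 2 + 1) := by gcongr

/-- Stochastically bounded steps stay in `T_n`, because its radius times `√n` diverges. -/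
theorem div_sqrt_mem_T {s : (Σ n, Fin n → 𝒳 × 𝒴) → ℝ}
    (hs : ∀ a : ℕ → ℝ, Tendsto a atTop atTop →
      ∀ᶠ p in probFilter (sampleLaw C.P), |s p| ≤ a p.1) :
    ∀ᶠ p in probFilter (sampleLaw C.P), s p / Real.sqrt p.1 ∈ D.T p.1 := by
  filter_upwards [hs _ (tendsto_radius h.rate),
    eventually_probFilter_of_atTop (eventually_gt_atTop 0)] with p h1 hn
  have hsn : 0 < Real.sqrt p.1 := Real.sqrt_pos.2 (by exact_mod_cast hn)
  simp only [T, Set.mem_ofPred_eq]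
  rwa [abs_div, abs_of_pos hsn, div_le_iff₀ hsn]

end LocalSetting

end Design

/-! ### Two inequalities for perturbed quadratics -/

/-- The step `-H / U` minimizes `2 s H + U s²`, with minimum `-H² / U`. The perturbations `x` of `H`
and `b` of `U` cost a quarter of `δ` each, and the remainder costs half. -/
theorem quadratic_lower_bound {c K U b H x δ Q : ℝ} (hc : 0 < c) (hcU : c ≤ U) (hUK : U ≤ K)
    (hx : |x - H| ≤ δ / 4) (hb : |b - U| ≤ c * (δ / 4))
    (hQ : -2 * (-H / U) * x - b * (-H / U) ^ 2
      - δ / (2 * (1 / c + K)) * ((-H / U) ^ 2 + 1) ≤ Q) :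
    H ^ 2 - δ * (H ^ 2 + 1) ≤ U * Q := by
  have hU : 0 < U := hc.trans_le hcU
  have hK : 0 < K := hU.trans_le hUK
  have hδ : 0 ≤ δ := by linarith [abs_nonneg (x - H)]
  have h1 := mul_le_mul_of_nonneg_left hQ hU.le
  have h2 : U * (-2 * (-H / U) * x - b * (-H / U) ^ 2
      - δ / (2 * (1 / c + K)) * ((-H / U) ^ 2 + 1))
      = H ^ 2 + 2 * (H * (x - H)) - (b - U) / U * H ^ 2
        - δ / (2 * (1 / c + K)) * (H ^ 2 / U + U) := by
    field_simp
    ring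
  have h3 : δ / (2 * (1 / c + K)) * (H ^ 2 / U + U) ≤ δ / 2 * (H ^ 2 + 1) := by
    have e1 : H ^ 2 / U ≤ H ^ 2 / c := by gcongr
    have e2 : H ^ 2 / U + U ≤ (1 / c + K) * (H ^ 2 + 1) := by
      have : 0 ≤ 1 / c := by positivity
      have : (1 / c + K) * (H ^ 2 + 1) = H ^ 2 / c + K + (1 / c + K * H ^ 2) := by ring
      have : 0 ≤ K * H ^ 2 := by positivity
      linarith
    calc _ ≤ δ / (2 * (1 / c + K)) * ((1 / c + K) * (H ^ 2 + 1)) := by gcongr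
      _ = _ := by field_simp
  have h4 : (b - U) / U * H ^ 2 ≤ δ / 4 * H ^ 2 := by
    have : (b - U) / U ≤ δ / 4 := by
      rw [div_le_iff₀ hU]
      have := le_of_abs_le hb
      nlinarith
    gcongr
  have h5 : |H * (x - H)| ≤ |H| * (δ / 4) := by
    rw [abs_mul]; gcongr
  have h6 := (abs_le.1 h5).1
  have h7 : |H| * (δ / 4) ≤ δ / 8 * (H ^ 2 + 1) := by
    have : 2 * |H| ≤ H ^ 2 + 1 := by nlinarith [sq_nonneg (|H| - 1), sq_abs H]
    nlinarith
  nlinarith [sq_nonneg H]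

/-- When `s U ≈ H`, `b ≈ U` and `w ≈ 0`, the product `U (2 s w + b s²)` is close to `(s U)² ≈ H²`.
The `3` comes from `(H + r)² ≤ 3 (H² + 1)` for `|r| ≤ 1`. With `18`, the errors other than the
remainder sum to less than `δ / 2`. -/
theorem quadratic_upper_bound {c K U b H s w δ Q : ℝ} (hc : 0 < c) (hcU : c ≤ U) (hUK : U ≤ K)
    (hδ1 : δ ≤ 1) (hs : |s * U - H| ≤ δ / 18) (hw : |w| ≤ δ / 18)
    (hb : |b - U| ≤ c * (δ / 18))
    (hQ : Q ≤ 2 * s * w + b * s ^ 2 + δ / (2 * (3 / c + K)) * (s ^ 2 + 1)) :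
    U * Q ≤ H ^ 2 + δ * (H ^ 2 + 1) := by
  have hU : 0 < U := hc.trans_le hcU
  have hK : 0 < K := hU.trans_le hUK
  have hδ : 0 ≤ δ := by linarith [abs_nonneg w]
  have h1 := mul_le_mul_of_nonneg_left hQ hU.le
  set r := s * U - H with hr
  have hsr : s = (H + r) / U := by rw [hr]; field_simp; ring
  have h2 : U * (2 * s * w + b * s ^ 2 + δ / (2 * (3 / c + K)) * (s ^ 2 + 1))
      = 2 * ((H + r) * w) + (H + r) ^ 2 + (b - U) / U * (H + r) ^ 2
        + δ / (2 * (3 / c + K)) * ((H + r) ^ 2 / U + U) := by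
    rw [hsr]
    field_simp
    ring
  have hH : 2 * |H| ≤ H ^ 2 + 1 := by nlinarith [sq_nonneg (|H| - 1), sq_abs H]
  have hr1 : |r| ≤ 1 := by linarith
  have h3 : (H + r) ^ 2 ≤ H ^ 2 + δ / 9 * (H ^ 2 + 1) := by
    have e1 : H * r ≤ |H| * (δ / 18) := by
      refine (le_abs_self _).trans ?_
      rw [abs_mul]
      gcongr
    have e2 : r ^ 2 ≤ δ / 18 := by
      rw [← sq_abs]
      nlinarith [abs_nonneg r]
    nlinarith [sq_nonneg H]
  have h3' : (H + r) ^ 2 ≤ 3 * (H ^ 2 + 1) := by nlinarith [sq_nonneg H]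
  have h4 : (H + r) * w ≤ (|H| + 1) * (δ / 18) := by
    refine (le_abs_self _).trans ?_
    rw [abs_mul]
    have : |H + r| ≤ |H| + 1 := (abs_add_le _ _).trans (by linarith)
    gcongr
  have h5 : (b - U) / U * (H + r) ^ 2 ≤ δ / 18 * (3 * (H ^ 2 + 1)) := by
    have : (b - U) / U ≤ δ / 18 := by
      rw [div_le_iff₀ hU]
      have := le_of_abs_le hb
      nlinarith
    gcongr
  have h6 : δ / (2 * (3 / c + K)) * ((H + r) ^ 2 / U + U) ≤ δ / 2 * (H ^ 2 + 1) := by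
    have e1 : (H + r) ^ 2 / U ≤ 3 * (H ^ 2 + 1) / c := by gcongr
    have e2 : (H + r) ^ 2 / U + U ≤ (3 / c + K) * (H ^ 2 + 1) := by
      have : (3 / c + K) * (H ^ 2 + 1) = 3 * (H ^ 2 + 1) / c + K + K * H ^ 2 := by ring
      have : 0 ≤ K * H ^ 2 := by positivity
      linarith
    calc _ ≤ δ / (2 * (3 / c + K)) * ((3 / c + K) * (H ^ 2 + 1)) := by gcongr
      _ = _ := by field_simp
  nlinarith [sq_nonneg H]

/-! ### Limits of the statistic -/

namespace Design

namespace LocalSetting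

variable {𝒳 𝒴 H : Type*} [MeasurableSpace 𝒳] [MeasurableSpace 𝒴] [StandardBorelSpace 𝒴]
  [Nonempty 𝒴] {dθ dρ : ℕ} [NormedAddCommGroup H] [NormedSpace ℝ H]
  {D : Design 𝒳 𝒴 dθ dρ H} {C : LocalCurve 𝒳 𝒴 dθ H} {R : Procedure 𝒳 𝒴 dθ dρ H}
  {v a0 : ℕ → Param dθ H} {B : ∀ n, (Fin n → 𝒳 × 𝒴) → ℝ} {κ phi0 : ℝ}
  (h : LocalSetting D C R v a0 B κ phi0)

include h

theorem bigOP_score :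
    BigOP (sampleLaw C.P) (fun n z => Real.sqrt n * D.scoreAvg C v n z) fun _ => 1 :=
  h.quadratic.clt.bigOP

theorem eventually_estR_mem_Nosn :
    ∀ᶠ p in probFilter (sampleLaw C.P), R.estR p.1 p.2 ∈ D.Nosn p.1 :=
  h.sample.estR_mem.eventually

theorem eventually_est_mem_Nosn :
    ∀ᶠ p in probFilter (sampleLaw C.P), R.est p.1 p.2 ∈ D.Nosn p.1 :=
  Design.eventually_est_mem_Nosn h.basic h.rate h.localc h.curve h.sample

/-- On the null the left side of `functional_expansion` loses its `φ` term, which ties the step to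
the deviation of its starting point. -/
theorem tendsto_deviation_add {α : (Σ n, Fin n → 𝒳 × 𝒴) → Param dθ H}
    {s : (Σ n, Fin n → 𝒳 × 𝒴) → ℝ}
    (hα : ∀ᶠ p in probFilter (sampleLaw C.P), α p ∈ D.Nosn p.1)
    (hs : ∀ᶠ p in probFilter (sampleLaw C.P), s p / Real.sqrt p.1 ∈ D.T p.1)
    (hnull : ∀ᶠ p in probFilter (sampleLaw C.P),
      D.phi (α p + (s p / Real.sqrt p.1) • D.scaled (v p.1)) = phi0) :
    Tendsto (fun p => deviation D v p.1 (α p) + s p * D.weakNorm (D.scaled (v p.1)) ^ 2)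
      (probFilter (sampleLaw C.P)) (𝓝 0) := by
  rw [Metric.tendsto_nhds]
  intro ε hε
  filter_upwards [hα, hs, hnull,
    eventually_probFilter_of_atTop (h.functional_expansion (half_pos hε)),
    eventually_probFilter_of_atTop (eventually_gt_atTop 0)] with p h1 h2 h3 h4 hn
  have hsn : 0 < Real.sqrt p.1 := Real.sqrt_pos.2 (by exact_mod_cast hn)
  have h5 := h4 _ h1 _ h2
  rw [h3, sub_self, zero_div, mul_zero, mul_div_cancel₀ _ hsn.ne'] at h5
  rw [Real.dist_eq, sub_zero, ← abs_neg]
  have h6 : -(deviation D v p.1 (α p) + s p * D.weakNorm (D.scaled (v p.1)) ^ 2)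
    = 0 - deviation D v p.1 (α p) - s p * D.weakNorm (D.scaled (v p.1)) ^ 2 := by ring
  rw [h6]
  linarith

theorem tendsto_deviation_estR : Tendsto (fun p => deviation D v p.1 (R.estR p.1 p.2))
    (probFilter (sampleLaw C.P)) (𝓝 0) := by
  have := h.tendsto_deviation_add (s := fun _ => 0) h.eventually_estR_mem_Nosn
    (Eventually.of_forall fun p => by simpa using h.zero_mem_T p.1)
    ((eventually_probFilter_of_atTop h.sample.estR_min.1).mono fun p hp => by
      simpa using (hp p.2).2)
  simpa using this

/-- The criterion at the unrestricted estimator compared with local paths. -/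
theorem est_le_path {α : (Σ n, Fin n → 𝒳 × 𝒴) → Param dθ H} {s : (Σ n, Fin n → 𝒳 × 𝒴) → ℝ}
    (hα : ∀ᶠ p in probFilter (sampleLaw C.P), α p ∈ D.Nosn p.1)
    (hs : ∀ᶠ p in probFilter (sampleLaw C.P), s p / Real.sqrt p.1 ∈ D.T p.1) {ε : ℝ}
    (hε : 0 < ε) : ∀ᶠ p in probFilter (sampleLaw C.P),
      p.1 * Qhat R p.1 p.2 (R.est p.1 p.2) ≤ p.1 * Qhat R p.1 p.2 (α p)
        + 2 * s p * (Real.sqrt p.1 * D.scoreAvg C v p.1 p.2 + deviation D v p.1 (α p)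
          - drift D C v p.1) + B p.1 p.2 * s p ^ 2 + ε * (s p ^ 2 + 1) := by
  filter_upwards [hα, hs, (h.isLittleO_expansion hα hs).bound (half_pos hε),
    h.eventually_Qhat_le h.sample.est_min h.eventually_est_mem_Nosn (half_pos hε),
    eventually_probFilter_of_atTop h.quadratic.path_mem] with p h1 h2 h3 h4 h5
  have h6 := h4 _ h1 _ h2 (h5 _ h1 _ h2)
  rw [Real.norm_eq_abs, Real.norm_of_nonneg (by positivity : 0 ≤ s p ^ 2 + 1)] at h3
  have h7 := (abs_le.1 h3).2
  nlinarith [sq_nonneg (s p)]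

/-- The criterion at the restricted estimator compared with local paths in the null. -/
theorem estR_le_path {α : (Σ n, Fin n → 𝒳 × 𝒴) → Param dθ H} {s : (Σ n, Fin n → 𝒳 × 𝒴) → ℝ}
    (hα : ∀ᶠ p in probFilter (sampleLaw C.P), α p ∈ D.Nosn p.1)
    (hs : ∀ᶠ p in probFilter (sampleLaw C.P), s p / Real.sqrt p.1 ∈ D.T p.1)
    (hnull : ∀ᶠ p in probFilter (sampleLaw C.P),
      D.phi (α p + (s p / Real.sqrt p.1) • D.scaled (v p.1)) = phi0) {ε : ℝ}
    (hε : 0 < ε) : ∀ᶠ p in probFilter (sampleLaw C.P),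
      p.1 * Qhat R p.1 p.2 (R.estR p.1 p.2) ≤ p.1 * Qhat R p.1 p.2 (α p)
        + 2 * s p * (Real.sqrt p.1 * D.scoreAvg C v p.1 p.2 + deviation D v p.1 (α p)
          - drift D C v p.1) + B p.1 p.2 * s p ^ 2 + ε * (s p ^ 2 + 1) := by
  filter_upwards [hα, hs, hnull, (h.isLittleO_expansion hα hs).bound (half_pos hε),
    h.eventually_Qhat_le h.sample.estR_min h.eventually_estR_mem_Nosn (half_pos hε),
    eventually_probFilter_of_atTop h.quadratic.path_mem] with p h1 h2 h0 h3 h4 h5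
  have h6 := h4 _ h1 _ h2 ⟨h5 _ h1 _ h2, h0⟩
  rw [Real.norm_eq_abs, Real.norm_of_nonneg (by positivity : 0 ≤ s p ^ 2 + 1)] at h3
  have h7 := (abs_le.1 h3).2
  nlinarith [sq_nonneg (s p)]

theorem eventually_abs_B_sub_le {η : ℝ} (hη : 0 < η) : ∀ᶠ p in probFilter (sampleLaw C.P),
    |B p.1 p.2 - D.weakNorm (D.scaled (v p.1)) ^ 2| ≤ η := by
  have := h.quadratic.B_approx.tendsto
  rw [Metric.tendsto_nhds] at this
  filter_upwards [this η hη] with p hp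
  rw [Real.dist_eq, sub_zero] at hp
  exact hp.le

theorem constant_div_sqrt_mem_T {s : (Σ n, Fin n → 𝒳 × 𝒴) → ℝ} {σ : ℝ}
    (hs : ∀ p, |s p| = σ) :
    ∀ᶠ p in probFilter (sampleLaw C.P), s p / Real.sqrt p.1 ∈ D.T p.1 :=
  h.div_sqrt_mem_T fun _ ha => (eventually_probFilter_of_atTop
    (ha.eventually_ge_atTop σ)).mono fun p hp => (hs p).trans_le hp

/-- The first order condition for the unrestricted estimator in the direction `u_n`. -/
theorem tendsto_first_order : Tendsto (fun p : Σ n, Fin n → 𝒳 × 𝒴 =>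
      Real.sqrt p.1 * D.scoreAvg C v p.1 p.2 + deviation D v p.1 (R.est p.1 p.2)
        - drift D C v p.1) (probFilter (sampleLaw C.P)) (𝓝 0) := by
  obtain ⟨c, K, hc, hK, hU⟩ := h.exists_scaled_bounds
  set w : (Σ n, Fin n → 𝒳 × 𝒴) → ℝ := fun p => Real.sqrt p.1 * D.scoreAvg C v p.1 p.2
    + deviation D v p.1 (R.est p.1 p.2) - drift D C v p.1 with hw
  rw [Metric.tendsto_nhds]
  intro η hη
  set σ := η / (K + 2) with hσ
  have hσ0 : 0 < σ := by positivity
  -- The sign opposes the slope `w`, so minimality gives `0 ≤ -2σ|w| + (K + 1)σ² + σ²`. Dividing by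
  -- `σ` bounds `2|w|` by `(K + 2)σ = η`.
  set s : (Σ n, Fin n → 𝒳 × 𝒴) → ℝ := fun p => if 0 ≤ w p then -σ else σ with hs
  have habs : ∀ p, |s p| = σ := fun p => by
    simp only [hs]
    split_ifs <;> simp [abs_of_pos hσ0]
  filter_upwards [h.est_le_path h.eventually_est_mem_Nosn (h.constant_div_sqrt_mem_T habs)
    (ε := σ ^ 2 / (σ ^ 2 + 1)) (by positivity), h.eventually_abs_B_sub_le one_pos,
    eventually_probFilter_of_atTop hU] with p h1 h2 h3
  have hsw : s p * w p = -(σ * |w p|) := by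
    simp only [hs]
    split_ifs with h0
    · rw [abs_of_nonneg h0]; ring
    · rw [abs_of_neg (not_le.1 h0)]; ring
  have hs2 : s p ^ 2 = σ ^ 2 := by rw [← sq_abs, habs]
  have h4 : σ ^ 2 / (σ ^ 2 + 1) * (σ ^ 2 + 1) = σ ^ 2 := by field_simp
  have h5 : B p.1 p.2 ≤ K + 1 := by linarith [le_of_abs_le h2, h3.2.2]
  have h6 : 0 ≤ 2 * s p * w p + B p.1 p.2 * s p ^ 2 + σ ^ 2 / (σ ^ 2 + 1) * (s p ^ 2 + 1) := by
    linarith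
  rw [mul_assoc, hsw, hs2, h4] at h6
  have h7 : B p.1 p.2 * σ ^ 2 ≤ (K + 1) * σ ^ 2 := by gcongr
  have h8 : 2 * |w p| ≤ (K + 2) * σ := by
    have : σ * (2 * |w p|) ≤ σ * ((K + 2) * σ) := by nlinarith
    exact le_of_mul_le_mul_left this hσ0
  have h9 : (K + 2) * σ = η := by rw [hσ]; field_simp
  rw [Real.dist_eq, sub_zero]
  have : 0 ≤ |w p| := abs_nonneg _
  linarith

/-- The statistic along local curves with convergent drift. -/
theorem tendsto_sqlr_sub_sq (hdrift : Tendsto (drift D C v) atTop (𝓝 κ)) :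
    Tendsto (fun p : Σ n, Fin n → 𝒳 × 𝒴 => D.weakNorm (D.scaled (v p.1)) ^ 2 * sqlr R p.1 p.2
      - (Real.sqrt p.1 * D.scoreAvg C v p.1 p.2 - κ) ^ 2)
      (probFilter (sampleLaw C.P)) (𝓝 0) := by
  obtain ⟨c, K, hc, hK, hU⟩ := h.exists_scaled_bounds
  have hH := h.bigOP_score.sub_const κ
  -- Errors proportional to `G² + 1` are allowed, since the centred score `G` is stochastically
  -- bounded.
  refine tendsto_zero_of_isLittleO_sq ?_ hH
  have hsmall : ∀ {f : (Σ n, Fin n → 𝒳 × 𝒴) → ℝ},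
      Tendsto f (probFilter (sampleLaw C.P)) (𝓝 0) → ∀ {ε : ℝ}, 0 < ε →
        ∀ᶠ p in probFilter (sampleLaw C.P), |f p| ≤ ε := by
    intro f hf ε hε
    rw [Metric.tendsto_nhds] at hf
    filter_upwards [hf ε hε] with p hp
    rw [Real.dist_eq, sub_zero] at hp
    exact hp.le
  have hdrift' : Tendsto (fun p : Σ n, Fin n → 𝒳 × 𝒴 => drift D C v p.1 - κ)
      (probFilter (sampleLaw C.P)) (𝓝 0) := by
    have := (hdrift.sub_const κ).comp (tendsto_fst_probFilter (μ := sampleLaw C.P))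
    rw [sub_self] at this
    exact this
  set G : (Σ n, Fin n → 𝒳 × 𝒴) → ℝ := fun p =>
    Real.sqrt p.1 * D.scoreAvg C v p.1 p.2 - κ with hG
  set U : (Σ n, Fin n → 𝒳 × 𝒴) → ℝ := fun p => D.weakNorm (D.scaled (v p.1)) ^ 2 with hUdef
  have hUp := eventually_probFilter_of_atTop (μ := sampleLaw C.P) hU
  have lower : ∀ δ : ℝ, 0 < δ → ∀ᶠ p in probFilter (sampleLaw C.P),
      G p ^ 2 - δ * (G p ^ 2 + 1) ≤ U p * sqlr R p.1 p.2 := by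
    intro δ hδ
    -- The step that minimizes the quadratic at the restricted estimator, where the deviation is
    -- negligible and the slope is close to `G`.
    have hs : ∀ᶠ p in probFilter (sampleLaw C.P),
        (-G p / U p) / Real.sqrt p.1 ∈ D.T p.1 := by
      refine h.div_sqrt_mem_T fun a ha => ?_
      filter_upwards [hH.eventually (ha.const_mul_atTop hc), hUp] with p h1 h2
      have hUpos : 0 < U p := hc.trans_le h2.2.1
      rw [abs_div, abs_neg, abs_of_pos hUpos, div_le_iff₀ hUpos]
      have h3 : 0 ≤ a p.1 := by
        have := (abs_nonneg _).trans h1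
        exact nonneg_of_mul_nonneg_right this hc
      calc |G p| ≤ c * a p.1 := h1
        _ ≤ a p.1 * U p := by rw [mul_comm]; gcongr; exact h2.2.1
    filter_upwards [hUp, h.est_le_path h.eventually_estR_mem_Nosn hs
      (ε := δ / (2 * (1 / c + K))) (by positivity),
      h.eventually_abs_B_sub_le (η := c * (δ / 4)) (by positivity),
      hsmall (by simpa using h.tendsto_deviation_estR.sub hdrift') (ε := δ / 4)
        (by positivity)] with p h1 h2 h3 h4
    refine quadratic_lower_bound (x := Real.sqrt p.1 * D.scoreAvg C v p.1 p.2
      + deviation D v p.1 (R.estR p.1 p.2) - drift D C v p.1) hc h1.2.1 h1.2.2 ?_ h3 ?_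
    · convert! h4 using 2
      simp only [hG]
      ring
    · rw [sqlr]
      linarith
  have upper : ∀ δ : ℝ, 0 < δ → δ ≤ 1 → ∀ᶠ p in probFilter (sampleLaw C.P),
      U p * sqlr R p.1 p.2 ≤ G p ^ 2 + δ * (G p ^ 2 + 1) := by
    intro δ hδ hδ1
    have hex : ∀ p : Σ n, Fin n → 𝒳 × 𝒴, ∃ t : ℝ, (∃ t ∈ D.T p.1,
        D.phi (R.est p.1 p.2 + t • D.scaled (v p.1)) = phi0) →
        t ∈ D.T p.1 ∧ D.phi (R.est p.1 p.2 + t • D.scaled (v p.1)) = phi0 := by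
      intro p
      by_cases hp : ∃ t ∈ D.T p.1, D.phi (R.est p.1 p.2 + t • D.scaled (v p.1)) = phi0
      · exact ⟨hp.choose, fun _ => hp.choose_spec⟩
      · exact ⟨0, fun hp' => absurd hp' hp⟩
    choose t ht using hex
    have hst : ∀ᶠ p in probFilter (sampleLaw C.P),
        (t p * Real.sqrt p.1) / Real.sqrt p.1 ∈ D.T p.1 ∧
        D.phi (R.est p.1 p.2 + ((t p * Real.sqrt p.1) / Real.sqrt p.1) • D.scaled (v p.1))
          = phi0 := by
      filter_upwards [h.eventually_est_mem_Nosn,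
        eventually_probFilter_of_atTop h.exists_path_null,
        eventually_probFilter_of_atTop (eventually_gt_atTop 0)] with p h1 h2 hn
      have hsn : 0 < Real.sqrt p.1 := Real.sqrt_pos.2 (by exact_mod_cast hn)
      rw [mul_div_cancel_right₀ _ hsn.ne']
      exact ht p (h2 _ h1)
    have hs := hst.mono fun p hp => hp.1
    have hnull := hst.mono fun p hp => hp.2
    -- Meeting the null gives `s U ≈ -deviation`, and the first order condition gives `-deviation ≈
    -- √n Z_n - drift`. Together `s U ≈ G`.
    have hY := h.tendsto_deviation_add h.eventually_est_mem_Nosn hs hnull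
    filter_upwards [hUp, h.estR_le_path h.eventually_est_mem_Nosn hs hnull
      (ε := δ / (2 * (3 / c + K))) (by positivity),
      h.eventually_abs_B_sub_le (η := c * (δ / 18)) (by positivity),
      hsmall h.tendsto_first_order (ε := δ / 18) (by positivity),
      hsmall (by simpa using (hY.sub h.tendsto_first_order).sub hdrift') (ε := δ / 18)
        (by positivity)] with p h1 h2 h3 h4 h5
    refine quadratic_upper_bound (s := t p * Real.sqrt p.1) (w := Real.sqrt p.1 *
      D.scoreAvg C v p.1 p.2 + deviation D v p.1 (R.est p.1 p.2) - drift D C v p.1)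
      hc h1.2.1 h1.2.2 hδ1 ?_ h4 h3 ?_
    · convert! h5 using 2
      simp only [hG, hUdef]
      ring
    · rw [sqlr]
      linarith
  rw [Asymptotics.isLittleO_iff]
  intro δ hδ
  filter_upwards [lower δ hδ, upper (min δ 1) (by positivity) (min_le_right _ _)] with p h1 h2
  have hpos : 0 ≤ G p ^ 2 + 1 := by positivity
  have h3 : min δ 1 * (G p ^ 2 + 1) ≤ δ * (G p ^ 2 + 1) := by gcongr; exact min_le_left _ _
  change ‖U p * sqlr R p.1 p.2 - G p ^ 2‖ ≤ δ * ‖G p ^ 2 + 1‖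
  rw [Real.norm_eq_abs, Real.norm_of_nonneg hpos, abs_le]
  constructor <;> linarith

/-- Divergence of the statistic along local curves with divergent drift. -/
theorem tendsto_sqlr_atTop (hdrift : Tendsto (fun n => |drift D C v n|) atTop atTop) :
    Tendsto (fun p : Σ n, Fin n → 𝒳 × 𝒴 => sqlr R p.1 p.2)
      (probFilter (sampleLaw C.P)) atTop := by
  obtain ⟨c, K, hc, hK, hU⟩ := h.exists_scaled_bounds
  set x : (Σ n, Fin n → 𝒳 × 𝒴) → ℝ := fun p => Real.sqrt p.1 * D.scoreAvg C v p.1 p.2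
    + deviation D v p.1 (R.estR p.1 p.2) - drift D C v p.1 with hx
  -- A unit step against the slope suffices, because the linear term alone diverges.
  set s : (Σ n, Fin n → 𝒳 × 𝒴) → ℝ := fun p => if 0 ≤ x p then -1 else 1 with hs
  have habs : ∀ p, |s p| = 1 := fun p => by
    simp only [hs]
    split_ifs <;> simp
  -- The step gives `sqlr ≥ 2|x| - (K + 1) - 2`. The slope satisfies `|x| ≥ |drift| / 2 - 1`, since
  -- the score is at most half the drift and the deviation at most `1`. The constants add up to `K +
  -- 5`.
  have hlim : Tendsto (fun n => |drift D C v n| - (K + 5)) atTop atTop :=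
    tendsto_atTop_add_const_right _ _ hdrift
  refine tendsto_atTop_mono' _ ?_ (hlim.comp (tendsto_fst_probFilter (μ := sampleLaw C.P)))
  have hdev := h.tendsto_deviation_estR
  rw [Metric.tendsto_nhds] at hdev
  filter_upwards [h.est_le_path h.eventually_estR_mem_Nosn (h.constant_div_sqrt_mem_T habs)
    one_pos, h.eventually_abs_B_sub_le one_pos, eventually_probFilter_of_atTop hU,
    hdev 1 one_pos, h.bigOP_score.eventually (hdrift.atTop_div_const two_pos)]
    with p h1 h2 h3 h4 h5
  rw [Real.dist_eq, sub_zero] at h4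
  have hsx : s p * x p = -|x p| := by
    simp only [hs]
    split_ifs with h0
    · rw [abs_of_nonneg h0]; ring
    · rw [abs_of_neg (not_le.1 h0)]; ring
  have hs2 : s p ^ 2 = 1 := by rw [← sq_abs, habs, one_pow]
  rw [mul_assoc (2 : ℝ), hsx, hs2] at h1
  have h6 : B p.1 p.2 ≤ K + 1 := by linarith [le_of_abs_le h2, h3.2.2]
  have h7 : |drift D C v p.1| ≤ |x p| + |Real.sqrt p.1 * D.scoreAvg C v p.1 p.2|
      + |deviation D v p.1 (R.estR p.1 p.2)| := by
    have : drift D C v p.1 = -x p + Real.sqrt p.1 * D.scoreAvg C v p.1 p.2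
        + deviation D v p.1 (R.estR p.1 p.2) := by simp only [hx]; ring
    rw [this]
    refine (abs_add_le _ _).trans (add_le_add_left ((abs_add_le _ _).trans ?_) _)
    rw [abs_neg]
  simp only [Function.comp_apply, sqlr]
  linarith

/-- The local asymptotics of any statistic that is asymptotically equivalent to the sieve quasi
likelihood ratio statistic. -/
theorem localAsymptotics {S : ∀ n, (Fin n → 𝒳 × 𝒴) → ℝ}
    (hS : ∀ n, AEMeasurable (S n) (sampleLaw C.P n))
    (hSS : Tendsto (fun p : Σ n, Fin n → 𝒳 × 𝒴 => S p.1 p.2 - sqlr R p.1 p.2)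
      (probFilter (sampleLaw C.P)) (𝓝 0)) : LocalAsymptotics D C v κ S := by
  obtain ⟨c, K, hc, hK, hU⟩ := h.exists_scaled_bounds
  refine ⟨fun hd => ?_, fun hd => ?_⟩
  · have hdrift : Tendsto (drift D C v) atTop (𝓝 κ) := by
      refine h.curve.dphi_tendsto.congr' ?_
      filter_upwards [hd, hU, eventually_gt_atTop 0] with n h1 h2 hn
      have hsn : 0 < Real.sqrt n := Real.sqrt_pos.2 (by exact_mod_cast hn)
      have := h2.1
      rw [h.drift_eq, h1]
      field_simp
    refine tendstoInDistribution_of_tendsto_sub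
      (tendstoInDistribution_noncentralChiSqOne h.quadratic.clt κ) ?_
      fun n => (hS n).const_mul _
    have h1 : Tendsto (fun p : Σ n, Fin n → 𝒳 × 𝒴 => D.weakNorm (D.scaled (v p.1)) ^ 2 *
        (S p.1 p.2 - sqlr R p.1 p.2)) (probFilter (sampleLaw C.P)) (𝓝 0) := by
      have h2 := (hSS.norm).const_mul K
      rw [norm_zero, mul_zero] at h2
      refine squeeze_zero_norm' ?_ h2
      filter_upwards [eventually_probFilter_of_atTop hU] with p hp
      rw [norm_mul, Real.norm_of_nonneg (sq_nonneg _)]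
      gcongr
      exact hp.2.2
    have h3 := h1.add (h.tendsto_sqlr_sub_sq hdrift)
    rw [add_zero] at h3
    exact h3.congr fun p => by ring
  · have hdrift : Tendsto (fun n => |drift D C v n|) atTop atTop := by
      simp only [h.drift_eq, abs_mul]
      exact (tendsto_abs_atTop_atTop.comp hd).atTop_mul_pos (abs_pos.2 h.curve.kappa_ne)
        h.curve.dphi_tendsto.abs
    have h1 : Tendsto (fun p : Σ n, Fin n → 𝒳 × 𝒴 => S p.1 p.2)
        (probFilter (sampleLaw C.P)) atTop := by
      refine (hSS.add_atTop (h.tendsto_sqlr_atTop hdrift)).congr fun p => ?_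
      ring
    refine tendstoInfInProb_of_tendsto (tendsto_atTop_mono' _ ?_ (h1.const_mul_atTop hc))
    filter_upwards [eventually_probFilter_of_atTop hU, h1.eventually_ge_atTop 0] with p hp hp'
    gcongr
    exact hp.2.1

/-- The statistic with the exact restricted infimum is asymptotically equivalent to the one with
the restricted estimator. -/
theorem tendsto_sqlrInf_sub_sqlr (hinf : ∀ ε : ℝ, 0 < ε → VanishingProb (sampleLaw C.P) fun n =>
      {z | ∃ α ∈ D.AkR phi0 n, Qhat R n z α + ε / n < Qhat R n z (R.estR n z)}) :
    Tendsto (fun p : Σ n, Fin n → 𝒳 × 𝒴 => D.sqlrInf R phi0 p.1 p.2 - sqlr R p.1 p.2)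
      (probFilter (sampleLaw C.P)) (𝓝 0) := by
  rw [Metric.tendsto_nhds]
  intro ε hε
  filter_upwards [(hinf (ε / 2) (half_pos hε)).eventually,
    eventually_probFilter_of_atTop h.sample.estR_min.1,
    eventually_probFilter_of_atTop (eventually_gt_atTop 0)] with p h1 h2 hn
  have hn' : (0 : ℝ) < p.1 := by exact_mod_cast hn
  -- This lower bound also ensures that the real `sInf` is a genuine infimum and not the default
  -- value of an unbounded set.
  have h3 : ∀ y ∈ Qhat R p.1 p.2 '' D.AkR phi0 p.1,
      Qhat R p.1 p.2 (R.estR p.1 p.2) - ε / 2 / p.1 ≤ y := by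
    rintro _ ⟨α, hα, rfl⟩
    have : ¬ _ := fun hlt => h1 ⟨α, hα, hlt⟩
    rw [not_lt] at this
    linarith
  have h4 : Qhat R p.1 p.2 (R.estR p.1 p.2) ∈ Qhat R p.1 p.2 '' D.AkR phi0 p.1 :=
    ⟨_, h2 p.2, rfl⟩
  have h5 := le_csInf ⟨_, h4⟩ h3
  have h6 := csInf_le ⟨_, h3⟩ h4
  have h7 : D.sqlrInf R phi0 p.1 p.2 - sqlr R p.1 p.2
      = p.1 * (sInf (Qhat R p.1 p.2 '' D.AkR phi0 p.1) - Qhat R p.1 p.2 (R.estR p.1 p.2)) := by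
    rw [sqlrInf, sqlr]
    ring
  have h8 : (p.1 : ℝ) * (-(ε / 2 / p.1)) ≤ D.sqlrInf R phi0 p.1 p.2 - sqlr R p.1 p.2 := by
    rw [h7]
    gcongr
    linarith
  have h9 : (p.1 : ℝ) * (-(ε / 2 / p.1)) = -(ε / 2) := by field_simp
  have h10 : D.sqlrInf R phi0 p.1 p.2 - sqlr R p.1 p.2 ≤ 0 := by
    rw [h7]
    exact mul_nonpos_of_nonneg_of_nonpos hn'.le (by linarith)
  rw [Real.dist_eq, sub_zero, abs_lt]
  constructor <;> linarith

end LocalSetting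

end Design

end PSMD

theorem mainTheorem7 {𝒳 𝒴 H : Type*} [MeasurableSpace 𝒳] [MeasurableSpace 𝒴]
    [StandardBorelSpace 𝒴] [Nonempty 𝒴] {dθ dρ : ℕ}
    [NormedAddCommGroup H] [NormedSpace ℝ H] [CompleteSpace H]
    (D : PSMD.Design 𝒳 𝒴 dθ dρ H) (C : PSMD.LocalCurve 𝒳 𝒴 dθ H)
    (R : PSMD.Procedure 𝒳 𝒴 dθ dρ H)
    (v a0 : ℕ → PSMD.Param dθ H) (B : ∀ n, (Fin n → 𝒳 × 𝒴) → ℝ) (κ phi0 : ℝ)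
    (hnull : D.phi D.alpha0 = phi0)
    (hv : D.IsSieveRiesz v) (ha0 : D.IsWeakProjection a0)
    (hbasic : D.BasicConditions) (hrate : D.RateConditions) (hlocal : D.LocalConditions)
    (hpen : D.PenaltyNegligible v) (hphi : D.FunctionalConditions v a0)
    (hcurve : D.CurveConditions C κ) (hsample : D.SampleConditions C R phi0)
    (hlaq : D.LocalQuadratic C R v B)
    (hmeas : ∀ n, AEMeasurable (PSMD.Design.sqlr R n) (PSMD.sampleLaw C.P n)) :
    PSMD.LocalAsymptotics D C v κ (PSMD.Design.sqlr R) ∧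
    ((∀ n, AEMeasurable (D.sqlrInf R phi0 n) (PSMD.sampleLaw C.P n)) →
      (∀ ε : ℝ, 0 < ε → PSMD.VanishingProb (PSMD.sampleLaw C.P) fun n =>
        {z | ∃ α ∈ D.AkR phi0 n,
          PSMD.Design.Qhat R n z α + ε / n < PSMD.Design.Qhat R n z (R.estR n z)}) →
      PSMD.LocalAsymptotics D C v κ (D.sqlrInf R phi0)) := by
  have h : PSMD.Design.LocalSetting D C R v a0 B κ phi0 :=
    ⟨hnull, hv, ha0, hbasic, hrate, hlocal, hpen, hphi, hcurve, hsample, hlaq⟩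
  refine ⟨h.localAsymptotics hmeas ?_, fun hmeasInf hinf =>
    h.localAsymptotics hmeasInf (h.tendsto_sqlrInf_sub_sqlr hinf)⟩
  simp only [sub_self]
  exact tendsto_const_nhds
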